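/- Let $X$ be a smooth, projective, absolutely irreducible curve over a finite field $\mathbb{F}_q$, with function field $\mathbb{F}_q(X)$. A (rational) divisor on $X$ is a finite formal sum $D=\sum_x n_x\, x$ of closed points $x$ of $X$ with coefficients $n_x\in\mathbb{Z}$; its support is $\{x \mid n_x\neq 0\}$, and its degree is $\deg D=\sum_x n_x\,[\kappa(x):\mathbb{F}_q]$, where $\kappa(x)$ is the residue field of $x$. A rational point of $X$ is a closed point of degree $1$. The Riemann–Roch space of $D$ is $$L(D)=\{h\in\mathbb{F}_q(X)\setminus\{0\} \mid (h)+D\geq 0\}\cup\{0\},$$ where $(h)=\sum_x \mathrm{ord}_x(h)\,x$, and the genus of $X$ is $g=1-\min_D\{\dim_{\mathbb{F}_q}L(D)-\deg D\}$, with $D$ ranging over all divisors on $X$. Let $\mathcal{P}=(P_1,\dots,P_n)$ be a tuple of $n\ge 0$ pairwise distinct rational points of $X$, and let $G$ be a divisor on $X$ whose support contains none of $P_1,\dots,P_n$. Let $$C_L(X,\mathcal{P},G)=\{(f(P_1),\dots,f(P_n)) \mid f\in L(G)\}\subseteq\mathbb{F}_q^n .$$ Suppose that $\deg G<n$. Then: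 1. the dimension $k$ of $C_L(X,\mathcal{P},G)$ over $\mathbb{F}_q$ satisfies $k\geq \deg G+1-g$; 2. if $\deg G>2g-2$, then $k=\deg G+1-g$; 3. if $C_L(X,\mathcal{P},G)\neq\{0\}$, then its minimum distance $d$ (the least Hamming distance between two distinct codewords) satisfies $d\geq n-\deg G$. -/

import Mathlib

open AlgebraicGeometry CategoryTheory

universe u

/-- A local domain, not a field, that is a localization of an algebra étale over `K[t]` is a
discrete valuation ring. -/
theorem isDiscreteValuationRing_of_etale_polynomial {K A B : Type*} [Field K] [CommRing A]
    [CommRing B] [IsDomain B] [IsLocalRing B] [IsNoetherianRing B] (hB : ¬ IsField B)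
    [Algebra A B] (g : MvPolynomial (Fin 1) K →+* A) (hg : g.Etale) (p : Ideal A) [p.IsPrime]
    [IsLocalization.AtPrime B p] : IsDiscreteValuationRing B := by
  algebraize [g]
  have : IsPrincipalIdealRing (MvPolynomial (Fin 1) K) :=
    .of_surjective (MvPolynomial.uniqueAlgEquiv K (Fin 1)).symm.toRingEquiv.toRingHom
      (MvPolynomial.uniqueAlgEquiv K (Fin 1)).symm.surjective
  let q : Ideal (MvPolynomial (Fin 1) K) := p.comap g
  have : p.LiesOver q := ⟨rfl⟩
  have hu : Algebra.IsUnramifiedAt (MvPolynomial (Fin 1) K) p := inferInstance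
  let := Localization.AtPrime.algebraOfLiesOver q p
  have h := ((Algebra.isUnramifiedAt_iff_map_eq (MvPolynomial (Fin 1) K) q p).1 hu).2
  refine ((IsDiscreteValuationRing.TFAE B hB).out 0 4).2 ?_
  let e := (IsLocalization.algEquiv p.primeCompl (Localization.AtPrime p) B).toRingEquiv
  have he : (IsLocalRing.maximalIdeal (Localization.AtPrime p)).map e =
      IsLocalRing.maximalIdeal B :=
    IsLocalRing.eq_maximalIdeal (Ideal.map_isMaximal_of_equiv e)
  rw [← he, ← h]
  obtain ⟨t, ht⟩ := (IsPrincipalIdealRing.principal q).principal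
  rw [ht, Ideal.submodule_span_eq, Ideal.map_span, Ideal.map_span]
  simp only [Set.image_singleton]
  exact ⟨_, rfl⟩

/-- A smooth, proper, absolutely irreducible curve over the field `k`: a scheme over `k` that is
smooth of relative dimension one, proper, and integral after every extension of the base field. -/
structure Curve (k : Type u) [Field k] where
  /-- the underlying scheme -/
  X : Scheme.{u}
  /-- the structure morphism -/
  toSpec : X ⟶ Spec (.of k)
  smooth : SmoothOfRelativeDimension 1 toSpec
  proper : IsProper toSpec
  geomIntegral : GeometricallyIntegral toSpec

namespace Curve

variable {k : Type u} [Field k] (C : Curve k)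

attribute [instance] smooth proper geomIntegral

instance : IsIntegral C.X := GeometricallyIntegral.isIntegral_of_subsingleton C.toSpec

instance : IsLocallyNoetherian C.X := LocallyOfFiniteType.isLocallyNoetherian C.toSpec

/-- The local rings at the points of codimension one are discrete valuation rings. -/
theorem isDiscreteValuationRing_stalk (x : C.X) (hx : Order.coheight x = 1) :
    IsDiscreteValuationRing (C.X.presheaf.stalk x) := by
  obtain ⟨U, hU, V, hV, hxV, e, h⟩ :=
    SmoothOfRelativeDimension.exists_isStandardSmoothOfRelativeDimension (n := 1)
      (f := C.toSpec) x
  obtain ⟨g, -, hg⟩ := h.exists_etale_mvPolynomial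
  have hUn : Nonempty U := ⟨⟨C.toSpec x, e hxV⟩⟩
  have hf : IsField Γ(Spec (.of k), U) := by
    have hs : Subsingleton (Spec (.of k)) := inferInstance
    have : Subsingleton U.toScheme := ⟨fun a b => Subtype.ext (hs.elim _ _)⟩
    have := isField_of_isIntegral_of_subsingleton U.toScheme
    exact MulEquiv.isField this (U.topIso.commRingCatIsoToRingEquiv.symm.toMulEquiv)
  let := hf.toField
  let := C.X.presheaf.algebra_section_stalk (⟨x, hxV⟩ : V)
  have := hV.isLocalization_stalk ⟨x, hxV⟩
  refine isDiscreteValuationRing_of_etale_polynomial ?_ g hg (hV.primeIdealOf ⟨x, hxV⟩).asIdeal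
  intro hF
  have := ringKrullDim_stalk_eq_coheight x
  rw [hx, ringKrullDim_eq_zero_of_isField hF] at this
  exact absurd this (by simp)

/-- The function field `k(X)` of the curve. -/
noncomputable abbrev functionField : Type u := C.X.functionField

/-- The constants, as global functions. -/
noncomputable def constants : k →+* Γ(C.X, ⊤) :=
  ((Scheme.ΓSpecIso (.of k)).inv ≫ C.toSpec.appTop).hom

/-- Every local ring of the curve (the function field among them) is a `k`-algebra. -/
noncomputable instance algebraStalk (x : C.X) : Algebra k (C.X.presheaf.stalk x) :=
  ((C.X.presheaf.germ ⊤ x trivial).hom.comp C.constants).toAlgebra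

/-- Every residue field of the curve is a `k`-algebra. -/
noncomputable instance algebraResidueField (x : C.X) : Algebra k (C.X.residueField x) :=
  ((C.X.residue x).hom.comp (algebraMap k (C.X.presheaf.stalk x))).toAlgebra

/-- The closed points of the curve. -/
abbrev ClosedPoint : Type u := closedPoints C.X

variable {C} in
/-- The degree `[κ(x) : k]` of a closed point `x`. -/
noncomputable def ClosedPoint.degree (x : C.ClosedPoint) : ℕ :=
  Module.finrank k (C.X.residueField x.1)

/-- The rational points of the curve: the closed points of degree one. -/
abbrev RationalPoint : Type u := {x : C.ClosedPoint // x.degree = 1}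

/-- The (rational) divisors on the curve: the formal `ℤ`-linear combinations of closed points. -/
abbrev Divisor : Type u := C.ClosedPoint →₀ ℤ

variable {C} in
/-- The degree `∑ nₓ [κ(x) : k]` of the divisor `∑ nₓ x`. -/
noncomputable def Divisor.degree (D : C.Divisor) : ℤ :=
  D.sum fun x m => m * (x.degree : ℤ)

theorem ord_algebraMap_mul (c : k) (hc : c ≠ 0) (h : C.functionField) (hh : h ≠ 0) (x : C.X) :
    Scheme.ord (algebraMap k C.functionField c * h) x = Scheme.ord h x := by
  have hc' : algebraMap k C.functionField c ≠ 0 := by simpa using hc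
  have hu : IsUnit (C.constants c) := (isUnit_iff_ne_zero.2 hc).map C.constants
  have : Nonempty (⊤ : C.X.Opens) := ⟨⟨x, trivial⟩⟩
  rw [Scheme.ord_mul hc' hh]
  have := Scheme.ord_of_isUnit hu (x := x) trivial
  change Scheme.ord (C.X.germToFunctionField ⊤ (C.constants c)) x + _ = _
  rw [this, zero_add]

/-- The Riemann–Roch space `L(D) = {h ∈ k(X) | (h) + D ≥ 0} ∪ {0}`, where the coefficient of the
divisor `(h)` at the closed point `x` is the order of vanishing of `h` at `x`. -/
noncomputable def L (D : C.Divisor) : Submodule k C.functionField where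
  carrier := {h | h ≠ 0 → ∀ x : C.ClosedPoint, 0 ≤ Scheme.ord h x.1 + D x}
  zero_mem' h := absurd rfl h
  add_mem' {a b} ha hb hab x := by
    by_cases ha0 : a = 0
    · subst ha0
      rw [zero_add] at hab ⊢
      exact hb hab x
    by_cases hb0 : b = 0
    · subst hb0
      rw [add_zero] at hab ⊢
      exact ha hab x
    have h1 := ha ha0 x
    have h2 := hb hb0 x
    by_cases hx : Order.coheight x.1 = 1
    · have := C.isDiscreteValuationRing_stalk x.1 hx
      have := Scheme.ord_add (x := x.1) hab
      rcases min_le_iff.1 this with h | h <;> linarith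
    · rw [Scheme.ord_eq_zero_of_coheight_neq_one hx] at h1 ⊢
      exact h1
  smul_mem' c h hh hch x := by
    have hc : c ≠ 0 := fun h0 => hch (by rw [h0, zero_smul])
    have h0 : h ≠ 0 := fun h0 => hch (by rw [h0, smul_zero])
    rw [Algebra.smul_def, C.ord_algebraMap_mul c hc h h0]
    exact hh h0 x

/-- The genus `g = 1 - min_D (dim L(D) - deg D)`, with `D` ranging over all divisors. -/
noncomputable def genus : ℤ :=
  1 - sInf (Set.range fun D : C.Divisor => (Module.finrank k (C.L D) : ℤ) - D.degree)

/-- The function `h` is regular at the point `x` and its value `h(x)` there is the constant `c`. -/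
def HasValueAt (h : C.functionField) (x : C.X) (c : k) : Prop :=
  ∃ s : C.X.presheaf.stalk x,
    algebraMap (C.X.presheaf.stalk x) C.functionField s = h ∧
      C.X.residue x s = algebraMap k (C.X.residueField x) c

/-- The algebraic geometry code `{(h(P₁), …, h(Pₙ)) | h ∈ L(G)}`. -/
def agCode {n : ℕ} (P : Fin n → C.RationalPoint) (G : C.Divisor) :
    Submodule k (Fin n → k) where
  carrier := {c | ∃ h ∈ C.L G, ∀ i, C.HasValueAt h (P i).1.1 (c i)}
  zero_mem' := ⟨0, zero_mem _, fun i => ⟨0, by simp, by simp⟩⟩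
  add_mem' := by
    rintro a b ⟨h, hh, ha⟩ ⟨h', hh', hb⟩
    refine ⟨h + h', add_mem hh hh', fun i => ?_⟩
    obtain ⟨s, hs, hs'⟩ := ha i
    obtain ⟨t, ht, ht'⟩ := hb i
    exact ⟨s + t, by rw [map_add, hs, ht], by rw [map_add, hs', ht', Pi.add_apply, map_add]⟩
  smul_mem' := by
    rintro r a ⟨h, hh, ha⟩
    refine ⟨r • h, Submodule.smul_mem _ r hh, fun i => ?_⟩
    obtain ⟨s, hs, hs'⟩ := ha i
    refine ⟨algebraMap k _ r * s, ?_, ?_⟩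
    · have : Nonempty (⊤ : C.X.Opens) := ⟨⟨(P i).1.1, trivial⟩⟩
      rw [map_mul, hs, Algebra.smul_def]
      congr 1
      exact Scheme.algebraMap_germ_eq_germToFunctionField C.X (U := ⊤) trivial (C.constants r)
    · rw [map_mul, hs', Pi.smul_apply, smul_eq_mul, map_mul]
      rfl

end Curve

open scoped Classical in
/-- `d` is the minimum distance of the code `A`, the least Hamming distance between two distinct
codewords (no `d` is, if `A` has only one codeword). -/
def IsMinDistance {k : Type*} [Field k] {n : ℕ} (A : Submodule k (Fin n → k)) (d : ℕ) : Prop :=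
  IsLeast {m : ℕ | ∃ a ∈ A, ∃ b ∈ A, a ≠ b ∧ m = hammingDist a b} d

/-!
The Riemann–Roch spaces of the curve are governed by its function field `K = k(X)` with the orders
at the closed points, and the inequalities of Riemann and Roch are proved in that setting
(`FunctionFieldPlaces`). The argument goes through adeles, as Weil's does. For divisors `D ≤ E` the
gap `deg E - deg D` is the growth of `L(D)` plus the growth of the adeles bounded by the divisor,
taken modulo functions (`relLength_adele_sup`); so the defect `deg D - dim L(D)` is monotone.

Principal divisors have degree zero (`degree_divisor`): by weak approximation, the degree of the
zeros of `x` is at most `m = [K : k(x)]` (`degree_zeros_le`), while the powers of `x` times a basis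
of `K` over `k(x)` make the space of `l` times the poles of `x` grow like `m l`
(`exists_mul_succ_le_dim`). Hence the defect depends on the linear equivalence class alone, and it
is bounded, since every divisor lies below a multiple of a fixed pole divisor up to equivalence
(`exists_degree_sub_dim_le`). So the minimum that defines the genus is attained, and
`dim L(D) ≥ deg D + 1 - g`. If the inequality is strict, there is a nonzero linear form on adeles
modulo functions that vanishes on the adeles bounded by `D`; its multiples by `L(D)` are independent
in a space of forms of dimension `g`, so `dim L(D) ≤ g` (`dim_le_genus`), which is impossible if
`deg D > 2 g - 2` (`dim_eq_of_lt_degree`).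

The geometry supplies the hypotheses of that theory (`Curve.places`). A chart étale over the affine
line shows that `K` is finitely generated of transcendence degree at most one, and that the local
rings at closed points are discrete valuation rings. Separatedness makes the local rings of distinct
points incomparable. A function without poles is a global section; global sections form a finite
extension `F` of `k`, and geometric integrality makes `F ⊗ F` a field, which forces `F = k`
(`Curve.mem_range_of_section`).

For the code, a nonzero function in `L(G)` that vanishes at the points of a set `T` of rational
points lies in `L(G - T)`, so `|T| ≤ deg G` (`Curve.card_le_degree`). As `deg G < n`, the evaluation
map is injective on `L(G)`, and the code has the dimension of `L(G)`; and two distinct codewords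
agree in at most `deg G` positions.
-/

/-! ### Relative length of submodules -/

namespace Submodule

variable {k V W : Type*} [Field k] [AddCommGroup V] [Module k V] [AddCommGroup W] [Module k W]

/-- The relative length of two subspaces: the dimension of `B / (A ∩ B)`, as an extended natural
number. -/
noncomputable def relLength (A B : Submodule k V) : ℕ∞ :=
  Module.length k (B ⧸ A.submoduleOf B)

theorem relLength_eq_length {A B : Submodule k V} (g : B →ₗ[k] W) (hg : Function.Surjective g)
    (h : ∀ b, g b = 0 ↔ (b : V) ∈ A) : relLength A B = Module.length k W := by
  have : A.submoduleOf B = LinearMap.ker g := by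
    ext b
    rw [LinearMap.mem_ker, h]
    rfl
  rw [relLength, this]
  exact (g.quotKerEquivOfSurjective hg).length_eq

theorem relLength_bot (B : Submodule k V) : relLength ⊥ B = Module.length k B :=
  relLength_eq_length LinearMap.id Function.surjective_id (by simp)

theorem relLength_eq_zero {A B : Submodule k V} : relLength A B = 0 ↔ B ≤ A := by
  rw [relLength, Module.length_eq_zero_iff, Submodule.Quotient.subsingleton_iff]
  exact Submodule.submoduleOf_eq_top

theorem relLength_inf_right (A B : Submodule k V) : relLength (A ⊓ B) B = relLength A B := by
  have : (A ⊓ B).submoduleOf B = A.submoduleOf B := by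
    ext b
    exact and_iff_left b.2
  rw [relLength, relLength, this]

theorem relLength_sup_right (A B : Submodule k V) : relLength A (A ⊔ B) = relLength A B := by
  rw [relLength]
  refine (relLength_eq_length ((A.submoduleOf (A ⊔ B)).mkQ ∘ₗ
    Submodule.inclusion (le_sup_right : B ≤ A ⊔ B)) ?_ ?_).symm
  · intro y
    obtain ⟨⟨y, hy⟩, rfl⟩ := Submodule.mkQ_surjective _ y
    obtain ⟨a, ha, b, hb, rfl⟩ := Submodule.mem_sup.1 hy
    refine ⟨⟨b, hb⟩, ?_⟩
    rw [LinearMap.comp_apply, ← sub_eq_zero, ← map_sub, Submodule.mkQ_apply,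
      Submodule.Quotient.mk_eq_zero]
    change b - (a + b) ∈ A
    simpa using ha
  · intro b
    rw [LinearMap.comp_apply, Submodule.mkQ_apply, Submodule.Quotient.mk_eq_zero]
    rfl

theorem relLength_trans {A B C : Submodule k V} (hAB : A ≤ B) (hBC : B ≤ C) :
    relLength A C = relLength A B + relLength B C := by
  have h1 : relLength (A.submoduleOf C) (B.submoduleOf C) = relLength A B := by
    refine (relLength_eq_length (A := A) (B := B) (((A.submoduleOf C).submoduleOf
      (B.submoduleOf C)).mkQ ∘ₗ (LinearMap.codRestrict (B.submoduleOf C)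
        (Submodule.inclusion hBC) fun b => b.2)) ?_ ?_).symm
    · refine (Submodule.mkQ_surjective _).comp ?_
      rintro ⟨⟨b, hb⟩, hb'⟩
      exact ⟨⟨b, hb'⟩, rfl⟩
    · intro b
      rw [LinearMap.comp_apply, Submodule.mkQ_apply, Submodule.Quotient.mk_eq_zero]
      rfl
  have hle : A.submoduleOf C ≤ B.submoduleOf C := fun x hx => hAB hx
  rw [← h1, relLength, relLength, relLength]
  refine Module.length_eq_add_of_exact
    (Submodule.liftQ _ ((A.submoduleOf C).mkQ ∘ₗ (B.submoduleOf C).subtype) ?_)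
    (Submodule.factor hle) ?_ (Submodule.factor_surjective hle) ?_
  · intro x hx
    rw [LinearMap.mem_ker, LinearMap.comp_apply, Submodule.mkQ_apply,
      Submodule.Quotient.mk_eq_zero]
    exact hx
  · rw [← LinearMap.ker_eq_bot]
    refine Submodule.ker_liftQ_eq_bot _ _ _ fun x hx => ?_
    rw [LinearMap.mem_ker, LinearMap.comp_apply, Submodule.mkQ_apply,
      Submodule.Quotient.mk_eq_zero] at hx
    exact hx
  · intro y
    obtain ⟨y, rfl⟩ := Submodule.mkQ_surjective _ y
    have : Submodule.factor hle ((A.submoduleOf C).mkQ y) = (B.submoduleOf C).mkQ y := rfl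
    rw [this, Submodule.mkQ_apply, Submodule.Quotient.mk_eq_zero]
    constructor
    · intro hy
      exact ⟨Submodule.Quotient.mk ⟨y, hy⟩, rfl⟩
    · rintro ⟨z, hz⟩
      obtain ⟨z, rfl⟩ := Submodule.mkQ_surjective _ z
      have h : ((A.submoduleOf C).mkQ z) = (A.submoduleOf C).mkQ y := hz
      rw [← sub_eq_zero, ← map_sub, Submodule.mkQ_apply, Submodule.Quotient.mk_eq_zero] at h
      have := sub_mem z.2 (hle h)
      simpa using this

/-- A subspace cuts a pair `D ≤ E` into its trace and its translates. -/
theorem relLength_eq_inf_add_sup {D E : Submodule k V} (h : D ≤ E) (K : Submodule k V) :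
    relLength D E = relLength (D ⊓ K) (E ⊓ K) + relLength (D ⊔ K) (E ⊔ K) := by
  have h1 : relLength (D ⊓ K) (E ⊓ K) = relLength D (D ⊔ E ⊓ K) := by
    rw [relLength_sup_right, ← relLength_inf_right D (E ⊓ K), ← inf_assoc, inf_eq_left.2 h]
  have h2 : relLength (D ⊔ K) (E ⊔ K) = relLength (D ⊔ E ⊓ K) E := by
    have e1 : E ⊔ K = (D ⊔ K) ⊔ E := by
      rw [sup_right_comm, sup_eq_right.2 h]
    have e2 : D ⊔ E ⊓ K = (D ⊔ K) ⊓ E := by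
      rw [sup_inf_assoc_of_le K h, inf_comm E K]
    rw [e1, relLength_sup_right, e2, relLength_inf_right]
  rw [h1, h2]
  exact relLength_trans le_sup_left (sup_le h inf_le_left)

theorem relLength_comap {f : V →ₗ[k] W} (hf : Function.Surjective f) (A B : Submodule k W) :
    relLength (A.comap f) (B.comap f) = relLength A B := by
  conv_rhs => rw [relLength]
  refine relLength_eq_length ((A.submoduleOf B).mkQ ∘ₗ
    (f.restrict (p := B.comap f) (q := B) fun x hx => hx)) ?_ ?_
  · refine (Submodule.mkQ_surjective _).comp ?_
    rintro ⟨b, hb⟩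
    obtain ⟨v, rfl⟩ := hf b
    exact ⟨⟨v, hb⟩, rfl⟩
  · intro b
    rw [LinearMap.comp_apply, Submodule.mkQ_apply, Submodule.Quotient.mk_eq_zero]
    rfl

theorem relLength_map {f : V →ₗ[k] W} (hf : Function.Injective f) (A B : Submodule k V) :
    relLength (A.map f) (B.map f) = relLength A B := by
  rw [relLength]
  refine (relLength_eq_length (((A.map f).submoduleOf (B.map f)).mkQ ∘ₗ
    (f.restrict (p := B) (q := B.map f) fun x hx => Submodule.mem_map_of_mem hx)) ?_ ?_).symm
  · refine (Submodule.mkQ_surjective _).comp ?_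
    rintro ⟨_, b, hb, rfl⟩
    exact ⟨⟨b, hb⟩, rfl⟩
  · intro b
    rw [LinearMap.comp_apply, Submodule.mkQ_apply, Submodule.Quotient.mk_eq_zero]
    change f b ∈ A.map f ↔ _
    simp [hf.eq_iff]

end Submodule

/-! ### Function fields with their places -/

/-- A family of discrete orders on a field `K`, trivial on a subfield `k`. The value of an order
at `0` is irrelevant. -/
structure DiscreteOrders (k K ι : Type*) [Field k] [Field K] [Algebra k K] where
  /-- the order of a nonzero element -/
  ord : ι → K → ℤ
  ord_mul : ∀ i {f g : K}, f ≠ 0 → g ≠ 0 → ord i (f * g) = ord i f + ord i g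
  ord_add : ∀ i {f g : K}, f ≠ 0 → g ≠ 0 → f + g ≠ 0 → min (ord i f) (ord i g) ≤ ord i (f + g)
  ord_algebraMap : ∀ i {c : k}, c ≠ 0 → ord i (algebraMap k K c) = 0

namespace DiscreteOrders

variable {k K ι : Type*} [Field k] [Field K] [Algebra k K] (S : DiscreteOrders k K ι)

/-- The elements whose order at `i` is at least `n`, together with `0`. -/
def filt (i : ι) (n : ℤ) : Submodule k K where
  carrier := {h | h ≠ 0 → n ≤ S.ord i h}
  zero_mem' h := absurd rfl h
  add_mem' {a b} ha hb hab := by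
    by_cases ha0 : a = 0
    · subst ha0
      rw [zero_add] at hab ⊢
      exact hb hab
    by_cases hb0 : b = 0
    · subst hb0
      rw [add_zero] at hab ⊢
      exact ha hab
    exact (le_min (ha ha0) (hb hb0)).trans (S.ord_add i ha0 hb0 hab)
  smul_mem' c h hh hch := by
    have hc : c ≠ 0 := fun h0 => hch (by rw [h0, zero_smul])
    have h0 : h ≠ 0 := fun h0 => hch (by rw [h0, smul_zero])
    rw [Algebra.smul_def, S.ord_mul i (by simpa using hc) h0, S.ord_algebraMap i hc, zero_add]
    exact hh h0

variable {S}

theorem filt_anti {i : ι} {m n : ℤ} (h : m ≤ n) : S.filt i n ≤ S.filt i m :=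
  fun _ hf h0 => h.trans (hf h0)

theorem mul_mem_filt {i : ι} {m n : ℤ} {f g : K} (hf : f ∈ S.filt i m) (hg : g ∈ S.filt i n) :
    f * g ∈ S.filt i (m + n) := fun h => by
  have hf0 := left_ne_zero_of_mul h
  have hg0 := right_ne_zero_of_mul h
  rw [S.ord_mul i hf0 hg0]
  exact add_le_add (hf hf0) (hg hg0)

theorem ord_mem_filt (i : ι) (f : K) : f ∈ S.filt i (S.ord i f) := fun _ => le_rfl

theorem ord_one (i : ι) : S.ord i 1 = 0 := by
  simpa using S.ord_algebraMap i (one_ne_zero (α := k))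

theorem ord_inv (i : ι) {f : K} (hf : f ≠ 0) : S.ord i f⁻¹ = -S.ord i f := by
  have := S.ord_mul i hf (inv_ne_zero hf)
  rw [mul_inv_cancel₀ hf, ord_one] at this
  linarith

theorem ord_neg (i : ι) {f : K} (hf : f ≠ 0) : S.ord i (-f) = S.ord i f := by
  have := S.ord_mul i (f := algebraMap k K (-1)) (by simp) hf
  rwa [S.ord_algebraMap i (by simp), zero_add, map_neg, map_one, neg_one_mul] at this

theorem ord_pow (i : ι) {f : K} (hf : f ≠ 0) (n : ℕ) : S.ord i (f ^ n) = n * S.ord i f := by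
  induction n with
  | zero => simp [ord_one]
  | succ n ih => rw [pow_succ, S.ord_mul i (pow_ne_zero n hf) hf, ih]; push_cast; ring

theorem ord_zpow (i : ι) {f : K} (hf : f ≠ 0) (n : ℤ) : S.ord i (f ^ n) = n * S.ord i f := by
  obtain ⟨n, rfl | rfl⟩ := n.eq_nat_or_neg
  · rw [zpow_natCast, ord_pow i hf]
  · rw [zpow_neg, ord_inv i (zpow_ne_zero _ hf), zpow_natCast, ord_pow i hf]; ring

/-- The strict triangle inequality is an equality. -/
theorem ord_add_eq_of_lt (i : ι) {f g : K} (hf : f ≠ 0) (hg : g ≠ 0) (h : S.ord i f < S.ord i g) :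
    f + g ≠ 0 ∧ S.ord i (f + g) = S.ord i f := by
  have h0 : f + g ≠ 0 := fun h0 => by
    rw [eq_neg_of_add_eq_zero_left h0, ord_neg i hg] at h
    exact lt_irrefl _ h
  refine ⟨h0, le_antisymm ?_ ?_⟩
  · have := S.ord_add i h0 (neg_ne_zero.2 hg) (by simpa using hf)
    rw [add_neg_cancel_right, ord_neg i hg] at this
    rcases min_le_iff.1 this with h' | h'
    · exact h'
    · exact absurd h (not_lt.2 h')
  · have := S.ord_add i hf hg h0
    rwa [min_eq_left h.le] at this

theorem filt_map_mulLeft (i : ι) {t : K} (ht : t ≠ 0) (n : ℤ) :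
    (S.filt i n).map (LinearMap.mulLeft k t) = S.filt i (S.ord i t + n) := by
  ext h
  constructor
  · rintro ⟨f, hf, rfl⟩
    exact mul_mem_filt (ord_mem_filt i t) hf
  · intro hh
    refine ⟨t⁻¹ * h, ?_, by simp [ht]⟩
    have := mul_mem_filt (ord_mem_filt i t⁻¹) hh
    rwa [ord_inv i ht, neg_add_cancel_left] at this

end DiscreteOrders

/-- A family `z` in a `k`-algebra is independent over the polynomials in `x`. -/
def PolyIndep {k K : Type*} [Field k] [Field K] [Algebra k K] (x : K) {m : ℕ} (z : Fin m → K) :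
    Prop :=
  ∀ p : Fin m → Polynomial k, ∑ j, Polynomial.aeval x (p j) * z j = 0 → p = 0

open DiscreteOrders in
/-- The places of a field `K` of algebraic functions of one variable with constant field `k`,
described by the properties on which the theorem of Riemann and Roch rests. -/
structure FunctionFieldPlaces (k K ι : Type*) [Field k] [Field K] [Algebra k K] extends
    DiscreteOrders k K ι where
  nonempty : Nonempty ι
  exists_ord_eq_one : ∀ i, ∃ t : K, t ≠ 0 ∧ ord i t = 1
  /-- the degree of the residue field -/
  deg : ι → ℕ
  relLength_residue : ∀ i, Submodule.relLength (toDiscreteOrders.filt i 1)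
    (toDiscreteOrders.filt i 0) = deg i
  finite_support : ∀ {h : K}, h ≠ 0 → {i | ord i h ≠ 0}.Finite
  /-- distinct places have incomparable valuation rings -/
  separated : ∀ {i j}, i ≠ j → ∃ h : K, h ≠ 0 ∧ 0 ≤ ord i h ∧ ord j h < 0
  /-- a function without poles is constant -/
  mem_range : ∀ {h : K}, h ≠ 0 → (∀ i, 0 ≤ ord i h) → h ∈ (algebraMap k K).range
  /-- `K` has finite degree over the field generated by a nonconstant function -/
  finite_rank : ∀ {x : K}, x ∉ (algebraMap k K).range → ∃ m : ℕ,
    (∃ u : Fin m → K, PolyIndep (k := k) x u) ∧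
      ∀ d : ℕ, ∀ z : Fin d → K, PolyIndep (k := k) x z → d ≤ m

/-- For a growing family of subspaces indexed by divisors, relative lengths are determined by the
growth at single places. -/
theorem exists_relLength_eq_sum {k V ι : Type*} [Field k] [AddCommGroup V] [Module k V]
    (T : (ι →₀ ℤ) → Submodule k V) (hT : Monotone T) (w : ι → ℕ)
    (hw : ∀ D i, Submodule.relLength (T D) (T (D + Finsupp.single i 1)) = w i)
    {D E : ι →₀ ℤ} (h : D ≤ E) :
    ∃ n : ℕ, Submodule.relLength (T D) (T E) = n ∧
      (n : ℤ) = (E - D).sum fun i m => m * (w i : ℤ) := by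
  classical
  let c : (ι →₀ ℕ) → (ι →₀ ℤ) := Finsupp.mapRange Nat.cast rfl
  have hadd (F G : ι →₀ ℕ) : c (F + G) = c F + c G := Finsupp.mapRange_add Nat.cast_add F G
  have hnn (F : ι →₀ ℕ) : 0 ≤ c F := fun i => by simp [c]
  let P : (ι →₀ ℕ) → Prop := fun F => ∀ D : ι →₀ ℤ, ∃ n : ℕ,
    Submodule.relLength (T D) (T (D + c F)) = n ∧ (n : ℤ) = (c F).sum fun i m => m * (w i : ℤ)
  have hP0 : P 0 := fun D => ⟨0, by simp [c, Submodule.relLength_eq_zero], by simp [c]⟩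
  have hPadd (F G : ι →₀ ℕ) (hF : P F) (hG : P G) : P (F + G) := by
    intro D
    obtain ⟨m, hm, hm'⟩ := hF D
    obtain ⟨n, hn, hn'⟩ := hG (D + c F)
    refine ⟨m + n, ?_, ?_⟩
    · rw [hadd, ← add_assoc, Submodule.relLength_trans (hT (le_add_of_nonneg_right (hnn F)))
        (hT (le_add_of_nonneg_right (hnn G))), hm, hn]
      simp
    · rw [hadd, Finsupp.sum_add_index' (fun _ => zero_mul _) (fun _ _ _ => add_mul _ _ _), ← hm',
        ← hn']
      simp
  have H (F : ι →₀ ℕ) : P F := by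
    induction F using Finsupp.induction_linear with
    | zero => exact hP0
    | add F G hF hG => exact hPadd F G hF hG
    | single i n =>
      induction n with
      | zero => simpa using hP0
      | succ n ih =>
        rw [Finsupp.single_add]
        exact hPadd _ _ ih fun D => ⟨w i, by simp [c, hw], by simp [c]⟩
  obtain ⟨n, hn, hn'⟩ := H ((E - D).mapRange Int.toNat rfl) D
  have e : c ((E - D).mapRange Int.toNat rfl) = E - D := by
    ext i
    have := h i
    simp only [c, Finsupp.mapRange_apply, Finsupp.sub_apply]
    omega
  rw [e] at hn hn'
  rw [add_sub_cancel] at hn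
  exact ⟨n, hn, hn'⟩

namespace FunctionFieldPlaces

open DiscreteOrders Submodule

variable {k K ι : Type*} [Field k] [Field K] [Algebra k K] (S : FunctionFieldPlaces k K ι)

theorem relLength_filt_succ (i : ι) (n : ℤ) :
    relLength (S.filt i (n + 1)) (S.filt i n) = S.deg i := by
  obtain ⟨t, ht, h1⟩ := S.exists_ord_eq_one i
  have hn : t ^ n ≠ 0 := zpow_ne_zero n ht
  have e (m : ℤ) : S.filt i (n + m) = (S.filt i m).map (LinearMap.mulLeft k (t ^ n)) := by
    rw [filt_map_mulLeft i hn, ord_zpow i ht, h1, mul_one]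
  have e0 := e 0
  rw [add_zero] at e0
  rw [e 1, e0, relLength_map, S.relLength_residue]
  exact mul_right_injective₀ hn

/-- The degree of a divisor. -/
noncomputable def degree (D : ι →₀ ℤ) : ℤ := D.sum fun i m => m * (S.deg i : ℤ)

theorem degree_add (D E : ι →₀ ℤ) : S.degree (D + E) = S.degree D + S.degree E := by
  classical
  exact Finsupp.sum_add_index' (fun _ => zero_mul _) fun _ _ _ => add_mul _ _ _

theorem degree_zero : S.degree 0 = 0 := Finsupp.sum_zero_index

theorem degree_neg (D : ι →₀ ℤ) : S.degree (-D) = -S.degree D := by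
  have := S.degree_add D (-D)
  rw [add_neg_cancel, degree_zero] at this
  linarith

theorem degree_sub (D E : ι →₀ ℤ) : S.degree (D - E) = S.degree D - S.degree E := by
  rw [sub_eq_add_neg, degree_add, degree_neg, sub_eq_add_neg]

theorem degree_nsmul (n : ℕ) (D : ι →₀ ℤ) : S.degree (n • D) = n * S.degree D := by
  induction n with
  | zero => simp [degree_zero]
  | succ n ih => rw [succ_nsmul, degree_add, ih]; push_cast; ring

theorem degree_single (i : ι) (n : ℤ) : S.degree (Finsupp.single i n) = n * S.deg i :=
  Finsupp.sum_single_index (zero_mul _)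

theorem degree_nonneg {D : ι →₀ ℤ} (h : 0 ≤ D) : 0 ≤ S.degree D :=
  Finset.sum_nonneg fun i _ => mul_nonneg (h i) (Int.natCast_nonneg _)

theorem degree_mono {D E : ι →₀ ℤ} (h : D ≤ E) : S.degree D ≤ S.degree E := by
  have := S.degree_nonneg (sub_nonneg.2 h)
  rw [degree_sub] at this
  linarith

/-! ### Adeles and Riemann–Roch spaces -/

/-- The adeles bounded by the divisor `D`: the families of functions `a` with `ord a_i ≥ -D i` for
every place `i`. Almost all components of such a family are integral, as `D` has finite support. -/
def adele (D : ι →₀ ℤ) : Submodule k (ι → K) := Submodule.pi Set.univ fun i => S.filt i (-D i)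

theorem mem_adele {D : ι →₀ ℤ} {a : ι → K} : a ∈ S.adele D ↔ ∀ i, a i ∈ S.filt i (-D i) := by
  simp [adele]

theorem adele_mono {D E : ι →₀ ℤ} (h : D ≤ E) : S.adele D ≤ S.adele E := fun a ha => by
  rw [mem_adele] at ha ⊢
  exact fun i => filt_anti (neg_le_neg (h i)) (ha i)

theorem relLength_adele_single (D : ι →₀ ℤ) (i : ι) :
    relLength (S.adele D) (S.adele (D + Finsupp.single i 1)) = S.deg i := by
  classical
  have hle : D ≤ D + Finsupp.single i 1 := le_add_of_nonneg_right (by simp)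
  have hi : -(D + Finsupp.single i 1 : ι →₀ ℤ) i + 1 = -D i := by simp
  have hp : Function.Surjective (LinearMap.proj i : (ι → K) →ₗ[k] K) :=
    LinearMap.proj_surjective i
  set E := D + Finsupp.single i 1 with hE
  have h1 : S.adele D = (S.filt i (-D i)).comap (LinearMap.proj i) ⊓ S.adele E := by
    refine le_antisymm (le_inf (fun a ha => S.mem_adele.1 ha i) (S.adele_mono hle)) ?_
    rintro a ⟨ha, ha'⟩
    rw [mem_adele]
    intro j
    by_cases hj : j = i
    · subst hj
      exact ha
    · have := S.mem_adele.1 ha' j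
      rwa [hE, Finsupp.add_apply, Finsupp.single_eq_of_ne hj, add_zero] at this
  have h2 : (S.filt i (-D i)).comap (LinearMap.proj i) ⊔ S.adele E =
      (S.filt i (-E i)).comap (LinearMap.proj i) := by
    refine le_antisymm (sup_le (Submodule.comap_mono (filt_anti (neg_le_neg (hle i))))
      fun a ha => S.mem_adele.1 ha i) fun a ha => ?_
    rw [← sub_add_cancel a (Pi.single i (a i))]
    refine Submodule.add_mem_sup (by simp) ?_
    rw [mem_adele]
    intro j
    by_cases hj : j = i
    · subst hj
      simpa using ha
    · simp [hj]
  rw [h1, relLength_inf_right, ← relLength_sup_right, h2, relLength_comap hp, ← hi,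
    relLength_filt_succ]

theorem relLength_adele {D E : ι →₀ ℤ} (h : D ≤ E) :
    ∃ n : ℕ, relLength (S.adele D) (S.adele E) = n ∧ (n : ℤ) = S.degree E - S.degree D := by
  rw [← degree_sub]
  exact exists_relLength_eq_sum S.adele (fun _ _ => S.adele_mono) S.deg S.relLength_adele_single h

/-- The principal adeles: a function, repeated at every place. -/
def diag (k K ι : Type*) [Field k] [Field K] [Algebra k K] : K →ₗ[k] (ι → K) :=
  LinearMap.pi fun _ => LinearMap.id

/-- The Riemann–Roch space of `D`. -/
def space (D : ι →₀ ℤ) : Submodule k K := (S.adele D).comap (diag k K ι)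

theorem mem_space {D : ι →₀ ℤ} {h : K} :
    h ∈ S.space D ↔ (h ≠ 0 → ∀ i, 0 ≤ S.ord i h + D i) := by
  change diag k K ι h ∈ S.adele D ↔ _
  rw [mem_adele]
  constructor
  · intro H h0 i
    have : -D i ≤ S.ord i h := H i h0
    linarith
  · intro H i h0
    have := H h0 i
    change -D i ≤ S.ord i h
    linarith

theorem space_mono {D E : ι →₀ ℤ} (h : D ≤ E) : S.space D ≤ S.space E :=
  Submodule.comap_mono (S.adele_mono h)

theorem relLength_adele_eq_add {D E : ι →₀ ℤ} (h : D ≤ E) :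
    relLength (S.adele D) (S.adele E) = relLength (S.space D) (S.space E) +
      relLength (S.adele D ⊔ LinearMap.range (diag k K ι))
        (S.adele E ⊔ LinearMap.range (diag k K ι)) := by
  obtain ⟨i⟩ := S.nonempty
  have hinj : Function.Injective (diag k K ι) := fun a b hab => congrFun hab i
  rw [relLength_eq_inf_add_sup (S.adele_mono h) (LinearMap.range (diag k K ι)),
    inf_comm, ← Submodule.map_comap_eq, inf_comm, ← Submodule.map_comap_eq, relLength_map hinj]
  rfl

/-- The only functions without poles are the constants. -/
theorem length_space_zero : Module.length k (S.space 0) = 1 := by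
  have : S.space 0 = k ∙ (1 : K) := by
    ext h
    rw [mem_space, Submodule.mem_span_singleton]
    constructor
    · intro H
      by_cases h0 : h = 0
      · exact ⟨0, by simp [h0]⟩
      obtain ⟨c, hc⟩ := S.mem_range h0 fun i => by simpa using H h0 i
      exact ⟨c, by rw [← hc, Algebra.smul_def, mul_one]⟩
    · rintro ⟨c, rfl⟩ h0 i
      rw [Algebra.smul_def, mul_one, S.ord_algebraMap i (fun hc => h0 (by simp [hc]))]
      simp
  rw [this, Module.length_eq_finrank, finrank_span_singleton one_ne_zero]
  rfl

theorem length_space_le {D : ι →₀ ℤ} (h : 0 ≤ D) :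
    ∃ n : ℕ, Module.length k (S.space D) ≤ n ∧ (n : ℤ) = S.degree D + 1 := by
  obtain ⟨n, hn, hn'⟩ := S.relLength_adele h
  refine ⟨n + 1, ?_, by rw [Nat.cast_add, hn', degree_zero]; simp⟩
  rw [← relLength_bot, relLength_trans bot_le (S.space_mono h), relLength_bot, length_space_zero,
    add_comm, Nat.cast_add, Nat.cast_one, ← hn, relLength_adele_eq_add S h]
  gcongr
  exact le_self_add

instance finite_space (D : ι →₀ ℤ) : Module.Finite k (S.space D) := by
  classical
  have hle : S.space D ≤ S.space (D ⊔ 0) := S.space_mono le_sup_left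
  obtain ⟨n, hn, -⟩ := S.length_space_le (D := D ⊔ 0) le_sup_right
  have hfin : IsFiniteLength k (S.space (D ⊔ 0)) :=
    Module.length_ne_top_iff.1 (ne_top_of_le_ne_top (ENat.natCast_ne_top n) hn)
  have : IsNoetherian k (S.space (D ⊔ 0)) :=
    (isFiniteLength_iff_isNoetherian_isArtinian.1 hfin).1
  have : Module.Finite k (S.space (D ⊔ 0)) := inferInstance
  exact Module.Finite.of_injective (Submodule.inclusion hle) (Submodule.inclusion_injective hle)

/-- The dimension of the Riemann–Roch space of `D`. -/
noncomputable def dim (D : ι →₀ ℤ) : ℕ := Module.finrank k (S.space D)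

theorem length_space (D : ι →₀ ℤ) : Module.length k (S.space D) = S.dim D :=
  Module.length_eq_finrank _ _

theorem dim_zero : S.dim 0 = 1 := by
  have := S.length_space 0
  rw [length_space_zero] at this
  exact_mod_cast this.symm

theorem dim_le_degree_add_one {D : ι →₀ ℤ} (h : 0 ≤ D) : (S.dim D : ℤ) ≤ S.degree D + 1 := by
  obtain ⟨n, hn, hn'⟩ := S.length_space_le h
  rw [length_space] at hn
  rw [← hn']
  exact_mod_cast hn

/-- Between `D` and `E ≥ D`, the gap `deg E - deg D` is the growth of the Riemann–Roch space plus
the growth of the space of adeles modulo functions. -/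
theorem relLength_adele_sup {D E : ι →₀ ℤ} (h : D ≤ E) : ∃ n : ℕ,
    relLength (S.adele D ⊔ LinearMap.range (diag k K ι))
      (S.adele E ⊔ LinearMap.range (diag k K ι)) = n ∧
    (n : ℤ) = (S.degree E - S.dim E) - (S.degree D - S.dim D) := by
  obtain ⟨m, hm, hm'⟩ := S.relLength_adele h
  have h1 := S.relLength_adele_eq_add h
  have h2 := relLength_trans (bot_le : ⊥ ≤ S.space D) (S.space_mono h)
  rw [relLength_bot, relLength_bot, length_space, length_space] at h2
  have ha : relLength (S.space D) (S.space E) ≠ ⊤ := fun ht => by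
    rw [ht, add_top] at h2
    exact ENat.natCast_ne_top _ h2
  have hb : relLength (S.adele D ⊔ LinearMap.range (diag k K ι))
      (S.adele E ⊔ LinearMap.range (diag k K ι)) ≠ ⊤ := fun ht => by
    rw [ht, add_top, hm] at h1
    exact ENat.natCast_ne_top _ h1
  obtain ⟨a, ha⟩ := ENat.ne_top_iff_exists.1 ha
  obtain ⟨b, hb⟩ := ENat.ne_top_iff_exists.1 hb
  rw [hm, ← ha, ← hb] at h1
  rw [← ha] at h2
  refine ⟨b, hb.symm, ?_⟩
  have h1' : m = a + b := by exact_mod_cast h1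
  have h2' : S.dim E = S.dim D + a := by exact_mod_cast h2
  rw [h1'] at hm'
  rw [h2']
  push_cast at hm' ⊢
  linarith

/-- The defect `deg D - dim L(D)` grows with `D`. -/
theorem degree_sub_dim_mono {D E : ι →₀ ℤ} (h : D ≤ E) :
    S.degree D - S.dim D ≤ S.degree E - S.dim E := by
  obtain ⟨n, -, hn⟩ := S.relLength_adele_sup h
  have := Int.natCast_nonneg n
  linarith

end FunctionFieldPlaces

namespace FunctionFieldPlaces

open DiscreteOrders Submodule

variable {k K ι : Type*} [Field k] [Field K] [Algebra k K] (S : FunctionFieldPlaces k K ι)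

/-! ### Approximation at finitely many places -/

/-- A function with a zero at one place and poles at finitely many others. -/
theorem exists_zero_poles (i : ι) (Z : Finset ι) (hi : i ∉ Z) :
    ∃ u : K, u ≠ 0 ∧ 0 < S.ord i u ∧ ∀ j ∈ Z, S.ord j u < 0 := by
  classical
  induction Z using Finset.induction_on with
  | empty =>
    obtain ⟨t, ht, h1⟩ := S.exists_ord_eq_one i
    exact ⟨t, ht, by omega, by simp⟩
  | insert l Z hl ih =>
    have hil : i ≠ l := fun h => hi (by simp [h])
    obtain ⟨u, hu, hui, huZ⟩ := ih fun h => hi (by simp [h])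
    obtain ⟨a, ha, hai, hal⟩ := S.separated hil
    obtain ⟨b, hb, hbl, hbi⟩ := S.separated hil.symm
    set w := a / b with hw
    have hw0 : w ≠ 0 := div_ne_zero ha hb
    have hord (j : ι) : S.ord j w = S.ord j a - S.ord j b := by
      rw [hw, div_eq_mul_inv, S.ord_mul j ha (inv_ne_zero hb), ord_inv j hb, sub_eq_add_neg]
    have hwi : 0 < S.ord i w := by rw [hord]; omega
    have hwl : S.ord l w < 0 := by rw [hord]; omega
    -- an exponent beating every `ord j w` with `j ∈ Z`
    let N : ℕ := ∑ j ∈ Z, (S.ord j w).natAbs + 1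
    have hN (j : ι) (hj : j ∈ Z) : S.ord j w + N * S.ord j u < 0 := by
      have h1 : (S.ord j w).natAbs ≤ ∑ j ∈ Z, (S.ord j w).natAbs :=
        Finset.single_le_sum (f := fun j => (S.ord j w).natAbs) (fun _ _ => Nat.zero_le _) hj
      have h2 : S.ord j w < N := by omega
      have h3 := huZ j hj
      nlinarith
    have hN0 : 0 < N := Nat.succ_pos _
    have huN : u ^ N ≠ 0 := pow_ne_zero N hu
    rcases lt_trichotomy (S.ord l u) 0 with hul | hul | hul
    · refine ⟨u, hu, hui, fun j hj => ?_⟩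
      rcases Finset.mem_insert.1 hj with rfl | hj
      · exact hul
      · exact huZ j hj
    · refine ⟨w * u ^ N, mul_ne_zero hw0 huN, ?_, fun j hj => ?_⟩
      · rw [S.ord_mul i hw0 huN, ord_pow i hu]
        positivity
      · rw [S.ord_mul j hw0 huN, ord_pow j hu]
        rcases Finset.mem_insert.1 hj with rfl | hj
        · rw [hul]; omega
        · exact hN j hj
    · -- `1 + u ^ N` is a unit at `i` and at `l`, and keeps the poles of `u ^ N`
      have hpos (j : ι) (hj : 0 < S.ord j u) :
          1 + u ^ N ≠ 0 ∧ S.ord j (1 + u ^ N) = 0 := by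
        have := ord_add_eq_of_lt (S := S.toDiscreteOrders) j one_ne_zero huN
          (by rw [ord_one, ord_pow j hu]; positivity)
        rwa [ord_one] at this
      have h0 := (hpos i hui).1
      refine ⟨w * (1 + u ^ N), mul_ne_zero hw0 h0, ?_, fun j hj => ?_⟩
      · rw [S.ord_mul i hw0 h0, (hpos i hui).2, add_zero]
        exact hwi
      · rw [S.ord_mul j hw0 h0]
        rcases Finset.mem_insert.1 hj with rfl | hj
        · rw [(hpos j hul).2, add_zero]
          exact hwl
        · have hneg : S.ord j (u ^ N) < 0 := by
            rw [ord_pow j hu]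
            have := huZ j hj
            have : (0 : ℤ) < N := by exact_mod_cast hN0
            nlinarith
          rw [add_comm, add_comm 1, (ord_add_eq_of_lt (S := S.toDiscreteOrders) j huN one_ne_zero
            (by rwa [ord_one])).2, ord_pow j hu, add_comm]
          exact hN j hj

/-- A function close to `1` at one place and close to `0` at finitely many others. -/
theorem exists_approx_one (i : ι) (Z : Finset ι) (hi : i ∉ Z) (N : ℕ) :
    ∃ e : K, e ∈ S.filt i 0 ∧ 1 - e ∈ S.filt i 1 ∧ ∀ j ∈ Z, e ∈ S.filt j N := by
  obtain ⟨u, hu, hui, huZ⟩ := S.exists_zero_poles i Z hi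
  have huN : u ^ (N + 1) ≠ 0 := pow_ne_zero _ hu
  have hc : (0 : ℤ) < ((N + 1 : ℕ) : ℤ) := by positivity
  obtain ⟨h0, hi0⟩ := ord_add_eq_of_lt (S := S.toDiscreteOrders) i one_ne_zero huN
    (by rw [ord_one, ord_pow i hu]; positivity)
  rw [ord_one] at hi0
  refine ⟨(1 + u ^ (N + 1))⁻¹, fun _ => ?_, fun _ => ?_, fun j hj _ => ?_⟩
  · rw [ord_inv i h0, hi0]; simp
  · have : 1 - (1 + u ^ (N + 1))⁻¹ = u ^ (N + 1) * (1 + u ^ (N + 1))⁻¹ := by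
      field_simp
      ring
    rw [this, S.ord_mul i huN (inv_ne_zero h0), ord_inv i h0, hi0, ord_pow i hu]
    nlinarith
  · have hneg : S.ord j (u ^ (N + 1)) < 0 := by
      rw [ord_pow j hu]
      have := huZ j hj
      nlinarith
    rw [ord_inv j h0, add_comm, (ord_add_eq_of_lt (S := S.toDiscreteOrders) j huN one_ne_zero
      (by rwa [ord_one])).2, ord_pow j hu]
    have := huZ j hj
    push_cast
    nlinarith

/-- The functions with prescribed bounds for their orders at the places in `Z`. -/
def semilocal (Z : Finset ι) (D : ι →₀ ℤ) : Submodule k K := ⨅ i ∈ Z, S.filt i (-D i)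

theorem mem_semilocal {Z : Finset ι} {D : ι →₀ ℤ} {h : K} :
    h ∈ S.semilocal Z D ↔ ∀ i ∈ Z, h ∈ S.filt i (-D i) := by
  simp [semilocal]

theorem semilocal_mono (Z : Finset ι) : Monotone (S.semilocal Z) := fun D E h f hf => by
  rw [mem_semilocal] at hf ⊢
  exact fun i hi => filt_anti (neg_le_neg (h i)) (hf i hi)

open Classical in
theorem relLength_semilocal_single (Z : Finset ι) (D : ι →₀ ℤ) (i : ι) :
    relLength (S.semilocal Z D) (S.semilocal Z (D + Finsupp.single i 1)) =
      ((if i ∈ Z then S.deg i else 0 : ℕ) : ℕ∞) := by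
  have hle : D ≤ D + Finsupp.single i 1 := le_add_of_nonneg_right (by simp)
  have hEj (j : ι) (hj : j ≠ i) : (D + Finsupp.single i 1 : ι →₀ ℤ) j = D j := by simp [hj]
  have hi : -(D + Finsupp.single i 1 : ι →₀ ℤ) i + 1 = -D i := by simp
  set E := D + Finsupp.single i 1
  split_ifs with hiZ
  · have h1 : S.semilocal Z D = S.filt i (-D i) ⊓ S.semilocal Z E := by
      refine le_antisymm (le_inf (fun a ha => S.mem_semilocal.1 ha i hiZ)
        (S.semilocal_mono Z hle)) ?_
      rintro a ⟨ha, ha'⟩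
      rw [mem_semilocal]
      intro j hj
      by_cases hji : j = i
      · subst hji
        exact ha
      · rw [← hEj j hji]
        exact S.mem_semilocal.1 ha' j hj
    have h2 : S.filt i (-D i) ⊔ S.semilocal Z E = S.filt i (-E i) := by
      refine le_antisymm (sup_le (filt_anti (neg_le_neg (hle i)))
        fun a ha => S.mem_semilocal.1 ha i hiZ) fun a ha => ?_
      -- an exponent clearing the poles of `a` to the required orders
      let N : ℕ := ∑ j ∈ Z, (-E j - S.ord j a).natAbs
      obtain ⟨e, he0, he1, heZ⟩ := S.exists_approx_one i (Z.erase i) (by simp) N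
      rw [← sub_add_cancel a (a * e)]
      refine Submodule.add_mem_sup ?_ ?_
      · rw [← hi, ← mul_one_sub]
        exact mul_mem_filt ha he1
      · rw [mem_semilocal]
        intro j hj
        by_cases hji : j = i
        · subst hji
          simpa using mul_mem_filt ha he0
        · have hN : (-E j - S.ord j a).natAbs ≤ N := Finset.single_le_sum
            (f := fun j => (-E j - S.ord j a).natAbs) (fun _ _ => Nat.zero_le _) hj
          exact filt_anti (by omega) (mul_mem_filt (ord_mem_filt (S := S.toDiscreteOrders) j a)
            (heZ j (by simp [hj, hji])))
    rw [h1, relLength_inf_right, ← relLength_sup_right, h2, ← hi, relLength_filt_succ]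
  · rw [Nat.cast_zero, relLength_eq_zero]
    intro a ha
    rw [mem_semilocal] at ha ⊢
    intro j hj
    rw [← hEj j fun h => hiZ (h ▸ hj)]
    exact ha j hj

/-! ### Principal divisors have degree zero -/

/-- The divisor of a nonzero function. -/
noncomputable def divisor {h : K} (h0 : h ≠ 0) : ι →₀ ℤ :=
  Finsupp.ofSupportFinite (fun i => S.ord i h) (S.finite_support h0)

theorem divisor_apply {h : K} (h0 : h ≠ 0) (i : ι) : S.divisor h0 i = S.ord i h := rfl

theorem divisor_inv {h : K} (h0 : h ≠ 0) : S.divisor (inv_ne_zero h0) = -S.divisor h0 := by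
  ext i
  simp [divisor_apply, ord_inv i h0]

theorem mem_space_iff {D : ι →₀ ℤ} {h : K} (h0 : h ≠ 0) :
    h ∈ S.space D ↔ 0 ≤ S.divisor h0 + D := by
  rw [mem_space]
  exact ⟨fun H i => H h0 i, fun H _ i => H i⟩

/-- Multiplication by `f` identifies the spaces of linearly equivalent divisors. -/
theorem dim_add_divisor (D : ι →₀ ℤ) {f : K} (h0 : f ≠ 0) :
    S.dim (D + S.divisor h0) = S.dim D := by
  have : (S.space (D + S.divisor h0)).map (LinearMap.mulLeft k f) = S.space D := by
    ext h
    constructor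
    · rintro ⟨a, ha, rfl⟩
      rw [SetLike.mem_coe, mem_space] at ha
      rw [mem_space, LinearMap.mulLeft_apply]
      intro hfa i
      have ha0 := right_ne_zero_of_mul hfa
      have := ha ha0 i
      rw [Finsupp.add_apply, divisor_apply] at this
      rw [S.ord_mul i h0 ha0]
      linarith
    · intro hh
      refine ⟨f⁻¹ * h, ?_, by simp [h0]⟩
      rw [mem_space] at hh
      rw [SetLike.mem_coe, mem_space]
      intro hfh i
      have hh0 := right_ne_zero_of_mul hfh
      have := hh hh0 i
      rw [Finsupp.add_apply, divisor_apply, S.ord_mul i (inv_ne_zero h0) hh0, ord_inv i h0]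
      linarith
  rw [dim, dim, ← this]
  exact (LinearEquiv.finrank_eq (Submodule.equivMapOfInjective _
    (mul_right_injective₀ h0) _))

/-- The degree of the zero divisor of `x` is at most the degree of `K` over `k(x)`: functions
independent modulo `x` in the ring of functions regular at the zeros of `x` are independent
over `k[x]`. -/
theorem degree_zeros_le {x : K} (h0 : x ≠ 0) {m : ℕ}
    (hm : ∀ d : ℕ, ∀ z : Fin d → K, PolyIndep (k := k) x z → d ≤ m) :
    S.degree (S.divisor h0 ⊔ 0) ≤ m := by
  classical
  set Z := S.divisor h0 ⊔ 0 with hZ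
  have hZ0 : 0 ≤ Z := le_sup_right
  have hZx (i : ι) (hi : i ∈ Z.support) : S.ord i x = Z i := by
    have h1 : Z i = max (S.ord i x) 0 := rfl
    have h2 : Z i ≠ 0 := Finsupp.mem_support_iff.1 hi
    omega
  let T := S.semilocal Z.support
  obtain ⟨d, hd, hd'⟩ := exists_relLength_eq_sum T (S.semilocal_mono Z.support) _
    (S.relLength_semilocal_single Z.support) (neg_le_neg hZ0)
  have hdeg : (d : ℤ) = S.degree Z := by
    rw [hd', degree]
    have : (-0 - -Z) = Z := by simp
    rw [this]
    refine Finsupp.sum_congr fun i hi => ?_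
    simp only [hi, if_true]
  rw [neg_zero] at hd
  have hx (f : K) (hf : f ∈ T 0) : x * f ∈ T (-Z) := by
    rw [mem_semilocal] at hf ⊢
    intro i hi
    have := mul_mem_filt (ord_mem_filt (S := S.toDiscreteOrders) i x) (hf i hi)
    rw [hZx i hi] at this
    simpa using this
  have hle : T (-Z) ≤ T 0 := S.semilocal_mono _ (by simpa using hZ0)
  have hpoly (p : Polynomial k) (f : K) (hf : f ∈ T 0) : Polynomial.aeval x p * f ∈ T 0 := by
    induction p using Polynomial.induction_on' with
    | add p q hp hq => rw [map_add, add_mul]; exact add_mem hp hq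
    | monomial n c =>
      rw [Polynomial.aeval_monomial, mul_assoc, ← Algebra.smul_def]
      refine Submodule.smul_mem _ c ?_
      induction n with
      | zero => simpa using hf
      | succ n ih => rw [pow_succ', mul_assoc]; exact hle (hx _ ih)
  let Q := T 0 ⧸ (T (-Z)).submoduleOf (T 0)
  have hQ : Module.length k Q = d := hd
  have : IsNoetherian k Q := (isFiniteLength_iff_isNoetherian_isArtinian.1
    (Module.length_ne_top_iff.1 (hQ ▸ ENat.natCast_ne_top d))).1
  have hfr : Module.finrank k Q = d := by
    rw [Module.length_eq_finrank] at hQ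
    exact_mod_cast hQ
  let b := Module.finBasisOfFinrankEq k Q hfr
  choose z hz using fun j => Submodule.mkQ_surjective _ (b j)
  have hind (c : Fin d → k) (h : ∑ j, c j • (z j : K) ∈ T (-Z)) : c = 0 := by
    have h1 : ∑ j, c j • b j = 0 := by
      simp_rw [← hz, ← map_smul, ← map_sum]
      rw [Submodule.mkQ_apply, Submodule.Quotient.mk_eq_zero]
      change ((∑ j, c j • z j : T 0) : K) ∈ T (-Z)
      simpa using h
    exact funext (Fintype.linearIndependent_iff.1 b.linearIndependent c h1)
  -- constant terms of a relation over `k[x]` vanish, by reduction modulo `x`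
  have hred (p : Fin d → Polynomial k) (hp : ∑ j, Polynomial.aeval x (p j) * (z j : K) = 0) :
      (fun j => (p j).coeff 0) = 0 := by
    refine hind _ ?_
    have : ∑ j, (p j).coeff 0 • (z j : K) =
        -(x * ∑ j, Polynomial.aeval x (p j).divX * (z j : K)) := by
      rw [eq_neg_iff_add_eq_zero, ← hp, Finset.mul_sum, ← Finset.sum_add_distrib]
      refine Finset.sum_congr rfl fun j _ => ?_
      conv_rhs => rw [← Polynomial.divX_mul_X_add (p j)]
      simp only [map_add, map_mul, Polynomial.aeval_X, Polynomial.aeval_C, Algebra.smul_def]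
      ring
    rw [this]
    exact neg_mem (hx _ (sum_mem fun j _ => hpoly _ _ (z j).2))
  rw [← hdeg]
  refine Int.ofNat_le.2 (hm d (fun j => z j) fun p hp => ?_)
  suffices H : ∀ n : ℕ, ∀ p : Fin d → Polynomial k,
      ∑ j, Polynomial.aeval x (p j) * (z j : K) = 0 → ∀ j, (p j).coeff n = 0 by
    funext j
    ext n
    simpa using H n p hp j
  intro n
  induction n with
  | zero =>
    intro p hp
    exact congrFun (hred p hp)
  | succ n ih =>
    intro p hp j
    have hc := hred p hp
    rw [← Polynomial.coeff_divX]
    refine ih (fun j => (p j).divX) ?_ j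
    have : x * ∑ j, Polynomial.aeval x (p j).divX * (z j : K) = 0 := by
      rw [← hp, Finset.mul_sum]
      refine Finset.sum_congr rfl fun j _ => ?_
      conv_rhs => rw [← Polynomial.divX_mul_X_add (p j), show (p j).coeff 0 = 0 from congrFun hc j]
      simp only [map_mul, Polynomial.aeval_X, map_zero, add_zero]
      ring
    exact (mul_eq_zero.1 this).resolve_left h0

theorem exists_mem_space (h : K) : ∃ C : ι →₀ ℤ, 0 ≤ C ∧ h ∈ S.space C := by
  classical
  by_cases h0 : h = 0
  · exact ⟨0, le_rfl, h0 ▸ zero_mem _⟩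
  · refine ⟨-S.divisor h0 ⊔ 0, le_sup_right, (S.mem_space_iff h0).2 ?_⟩
    rw [← neg_le_iff_add_nonneg']
    exact le_sup_left

theorem mul_mem_space {D E : ι →₀ ℤ} {f g : K} (hf : f ∈ S.space D) (hg : g ∈ S.space E) :
    f * g ∈ S.space (D + E) := by
  rw [mem_space] at hf hg ⊢
  intro h i
  have hf0 := left_ne_zero_of_mul h
  have hg0 := right_ne_zero_of_mul h
  have h1 := hf hf0 i
  have h2 := hg hg0 i
  rw [S.ord_mul i hf0 hg0, Finsupp.add_apply]
  linarith

theorem one_mem_space_zero : (1 : K) ∈ S.space 0 := by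
  rw [mem_space]
  intro _ i
  rw [ord_one]
  simp

theorem pow_mem_space {D : ι →₀ ℤ} {f : K} (hf : f ∈ S.space D) (n : ℕ) :
    f ^ n ∈ S.space (n • D) := by
  induction n with
  | zero => simpa using S.one_mem_space_zero
  | succ n ih => rw [pow_succ, succ_nsmul]; exact S.mul_mem_space ih hf

/-- The products of powers of `x` with functions independent over `k[x]` make the spaces of
multiples of the pole divisor of `x` grow. -/
theorem exists_mul_succ_le_dim {x : K} {P : ι →₀ ℤ} (hP : 0 ≤ P) (hx : x ∈ S.space P) {m : ℕ}
    {u : Fin m → K} (hu : PolyIndep (k := k) x u) :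
    ∃ C : ι →₀ ℤ, 0 ≤ C ∧ ∀ l : ℕ, m * (l + 1) ≤ S.dim (l • P + C) := by
  classical
  choose c hc0 hc using fun j => S.exists_mem_space (u j)
  refine ⟨∑ j, c j, Finset.sum_nonneg fun j _ => hc0 j, fun l => ?_⟩
  have hmem (q : Fin (l + 1) × Fin m) : x ^ (q.1 : ℕ) * u q.2 ∈ S.space (l • P + ∑ j, c j) := by
    refine S.space_mono (add_le_add ?_ ?_) (S.mul_mem_space (S.pow_mem_space hx q.1) (hc q.2))
    · exact nsmul_le_nsmul_left hP (Nat.lt_succ_iff.1 q.1.2)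
    · exact Finset.single_le_sum (fun j _ => hc0 j) (Finset.mem_univ q.2)
  have hli : LinearIndependent k (fun q : Fin (l + 1) × Fin m =>
      (⟨x ^ (q.1 : ℕ) * u q.2, hmem q⟩ : S.space (l • P + ∑ j, c j))) := by
    rw [Fintype.linearIndependent_iff]
    intro g hg
    have hg' : ∑ q : Fin (l + 1) × Fin m, g q • (x ^ (q.1 : ℕ) * u q.2) = 0 := by
      simpa using congrArg Subtype.val hg
    have h1 := hu (fun j => ∑ i : Fin (l + 1), Polynomial.monomial (i : ℕ) (g (i, j))) <| by
      rw [← hg', Fintype.sum_prod_type_right]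
      refine Finset.sum_congr rfl fun j _ => ?_
      rw [map_sum, Finset.sum_mul]
      refine Finset.sum_congr rfl fun i _ => ?_
      rw [Polynomial.aeval_monomial, Algebra.smul_def, mul_assoc]
    rintro ⟨i, j⟩
    have h2 := congrArg (fun p : Polynomial k => p.coeff i) (congrFun h1 j)
    simpa [Polynomial.finsetSum_coeff, Polynomial.coeff_monomial, Fin.val_inj] using h2
  have := hli.fintype_card_le_finrank
  rw [Fintype.card_prod, Fintype.card_fin, Fintype.card_fin, mul_comm] at this
  exact this

/-- A space of dimension at most `l deg P + deg C + 1` that grows at least like `m l` forces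
`m ≤ deg P`. -/
theorem le_degree_poles {P : ι →₀ ℤ} (hP : 0 ≤ P) {m : ℕ} {C : ι →₀ ℤ} (hC : 0 ≤ C)
    (h : ∀ l : ℕ, m * (l + 1) ≤ S.dim (l • P + C)) : m ≤ S.degree P := by
  by_contra! hlt
  have hC' := S.degree_nonneg hC
  obtain ⟨c, hc⟩ := Int.eq_ofNat_of_zero_le hC'
  have h1 : ((m * ((c + 1) + 1) : ℕ) : ℤ) ≤ S.dim ((c + 1) • P + C) := by exact_mod_cast h (c + 1)
  have h2 := S.dim_le_degree_add_one (add_nonneg (nsmul_nonneg hP (c + 1)) hC)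
  rw [degree_add, degree_nsmul, hc] at h2
  have hP' := S.degree_nonneg hP
  push_cast at h1 h2
  nlinarith

theorem mem_space_poles {x : K} (h0 : x ≠ 0) : x ∈ S.space (-S.divisor h0 ⊔ 0) := by
  rw [S.mem_space_iff h0, ← neg_le_iff_add_nonneg']
  exact le_sup_left

/-- The zeros of a nonconstant `x` number at most `[K : k(x)]`, and its poles at least as many; the
same holds for `x⁻¹`. -/
theorem degree_divisor {x : K} (h0 : x ≠ 0) : S.degree (S.divisor h0) = 0 := by
  by_cases hx : x ∈ (algebraMap k K).range
  · obtain ⟨c, rfl⟩ := hx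
    have : S.divisor h0 = 0 := by
      ext i
      exact S.ord_algebraMap i fun hc => h0 (by rw [hc, map_zero])
    rw [this, degree_zero]
  have key (y : K) (hy0 : y ≠ 0) (hy : y ∉ (algebraMap k K).range) :
      S.degree (S.divisor hy0 ⊔ 0) ≤ S.degree (-S.divisor hy0 ⊔ 0) := by
    obtain ⟨m, ⟨u, hu⟩, hm⟩ := S.finite_rank hy
    obtain ⟨C, hC, hdim⟩ := S.exists_mul_succ_le_dim le_sup_right (S.mem_space_poles hy0) hu
    exact (S.degree_zeros_le hy0 hm).trans (S.le_degree_poles le_sup_right hC hdim)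
  have h1 := key x h0 hx
  have h2 := key x⁻¹ (inv_ne_zero h0) fun ⟨c, hc⟩ =>
    hx ⟨c⁻¹, by rw [map_inv₀, hc, inv_inv]⟩
  rw [S.divisor_inv h0, neg_neg] at h2
  have h3 : S.divisor h0 = (S.divisor h0 ⊔ 0) - (-S.divisor h0 ⊔ 0) := by
    ext i
    simp only [Finsupp.sub_apply, Finsupp.sup_apply, Finsupp.neg_apply, Finsupp.zero_apply]
    omega
  rw [h3, degree_sub]
  linarith

theorem degree_nonneg_of_mem_space {D : ι →₀ ℤ} {h : K} (h0 : h ≠ 0) (hh : h ∈ S.space D) :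
    0 ≤ S.degree D := by
  have := S.degree_nonneg ((S.mem_space_iff h0).1 hh)
  rwa [degree_add, degree_divisor, zero_add] at this

theorem deg_pos (i : ι) : 0 < S.deg i := by
  rw [Nat.pos_iff_ne_zero]
  intro h
  have h1 := S.relLength_residue i
  rw [h, Nat.cast_zero, relLength_eq_zero] at h1
  have h2 : (1 : ℤ) ≤ S.ord i 1 :=
    h1 (show (1 : K) ∈ S.filt i 0 from fun _ => by rw [ord_one]) one_ne_zero
  rw [ord_one] at h2
  omega

/-! ### The theorem of Riemann -/

theorem exists_degree_sub_dim_le : ∃ c : ℤ, ∀ D : ι →₀ ℤ, S.degree D - S.dim D ≤ c := by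
  classical
  obtain ⟨i⟩ := S.nonempty
  obtain ⟨t, ht, hti⟩ := S.exists_ord_eq_one i
  -- the inverse of a uniformizer at `i` has a pole at `i`
  have hx0 : t⁻¹ ≠ 0 := inv_ne_zero ht
  have hxi : S.ord i t⁻¹ = -1 := by rw [ord_inv i ht, hti]
  have hx : t⁻¹ ∉ (algebraMap k K).range := by
    rintro ⟨c, hc⟩
    rw [← hc, S.ord_algebraMap i fun h => hx0 (by rw [← hc, h, map_zero])] at hxi
    omega
  obtain ⟨m, ⟨u, hu⟩, hm⟩ := S.finite_rank hx
  set P := -S.divisor hx0 ⊔ 0 with hP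
  have hP0 : 0 ≤ P := le_sup_right
  obtain ⟨C, hC, hdim⟩ := S.exists_mul_succ_le_dim hP0 (S.mem_space_poles hx0) hu
  have hPm : S.degree P ≤ m := by
    have h1 := S.degree_zeros_le hx0 hm
    have h2 : S.divisor hx0 = (S.divisor hx0 ⊔ 0) - P := by
      ext i
      simp only [hP, Finsupp.sub_apply, Finsupp.sup_apply, Finsupp.neg_apply, Finsupp.zero_apply]
      omega
    have h3 := S.degree_divisor hx0
    rw [h2, degree_sub] at h3
    linarith
  have hPpos : 1 ≤ S.degree P := by
    have h1 : Finsupp.single i 1 ≤ P := by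
      intro j
      by_cases hj : j = i
      · subst hj
        have : P j = max (-S.ord j t⁻¹) 0 := rfl
        rw [Finsupp.single_eq_same, this, hxi]
        omega
      · rw [Finsupp.single_eq_of_ne hj]
        exact hP0 j
    have h2 := S.degree_mono h1
    rw [degree_single] at h2
    have := S.deg_pos i
    omega
  have hbound (l : ℕ) : S.degree (l • P) - S.dim (l • P) ≤ S.degree C := by
    have h1 := S.degree_sub_dim_mono (le_add_of_nonneg_right hC : l • P ≤ l • P + C)
    have h2 : (m : ℤ) * (l + 1) ≤ S.dim (l • P + C) := by exact_mod_cast hdim l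
    rw [degree_add, degree_nsmul] at h1
    rw [degree_nsmul]
    nlinarith
  refine ⟨S.degree C, fun D => ?_⟩
  -- `D` is bounded by a multiple of `P`, up to the divisor of a function
  obtain ⟨l, hl⟩ : ∃ l : ℕ, S.degree C + S.degree (D ⊔ 0) < l :=
    ⟨(S.degree C + S.degree (D ⊔ 0) + 1).toNat, by omega⟩
  have h1 := S.degree_sub_dim_mono (sub_le_self (l • P) (le_sup_right : 0 ≤ D ⊔ 0))
  have h2 := (h1.trans (hbound l))
  rw [degree_sub, degree_nsmul] at h2
  have h3 : 0 < S.dim (l • P - D ⊔ 0) := by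
    have : (0 : ℤ) < S.dim (l • P - D ⊔ 0) := by nlinarith
    exact_mod_cast this
  have := Module.finrank_pos_iff.1 h3
  obtain ⟨⟨f, hf⟩, hf0⟩ := exists_ne (0 : S.space (l • P - D ⊔ 0))
  have hf0 : f ≠ 0 := fun h => hf0 (Subtype.ext h)
  have h4 : D ≤ l • P + S.divisor hf0 := by
    have := (S.mem_space_iff hf0).1 hf
    intro i
    have h5 := this i
    have h6 : D i ≤ (D ⊔ 0 : ι →₀ ℤ) i := le_max_left _ _
    rw [Finsupp.add_apply, Finsupp.sub_apply, Finsupp.zero_apply] at h5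
    rw [Finsupp.add_apply]
    linarith
  have h5 := S.degree_sub_dim_mono h4
  rw [dim_add_divisor, degree_add, degree_divisor, add_zero] at h5
  exact h5.trans (hbound l)

/-- The genus of a function field. The infimum is attained, by `genus_spec`. -/
noncomputable def genus : ℤ := 1 - sInf (Set.range fun D : ι →₀ ℤ => (S.dim D : ℤ) - S.degree D)

theorem genus_spec : (∃ D : ι →₀ ℤ, (S.dim D : ℤ) = S.degree D + 1 - S.genus) ∧
    ∀ D : ι →₀ ℤ, S.degree D + 1 - S.genus ≤ S.dim D := by
  obtain ⟨c, hc⟩ := S.exists_degree_sub_dim_le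
  have hb : BddBelow (Set.range fun D : ι →₀ ℤ => (S.dim D : ℤ) - S.degree D) :=
    ⟨-c, by rintro _ ⟨D, rfl⟩; have := hc D; dsimp only; linarith⟩
  constructor
  · obtain ⟨D, hD⟩ := Int.csInf_mem (Set.range_nonempty _) hb
    refine ⟨D, ?_⟩
    rw [genus, ← hD]
    ring
  · intro D
    have := csInf_le hb (Set.mem_range_self D)
    rw [genus]
    linarith

/-! ### The theorem of Riemann and Roch -/

theorem mul_mem_adele {D E : ι →₀ ℤ} {f : K} (hf : f ∈ S.space D) {a : ι → K}
    (ha : a ∈ S.adele E) : (fun i => f * a i) ∈ S.adele (D + E) := by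
  rw [mem_adele] at ha ⊢
  intro i
  have h1 : f ∈ S.filt i (-D i) := S.mem_adele.1 (show diag k K ι f ∈ S.adele D from hf) i
  have := mul_mem_filt h1 (ha i)
  rwa [← neg_add] at this

/-- If the space of `D` is larger than the inequality of Riemann demands, there is a nonzero
linear form on adeles modulo functions that vanishes on the adeles bounded by `D`; its multiples by
the functions in `L(D)` are independent, and vanish on the integral adeles. Those forms make up a
space of dimension `g`. -/
theorem dim_le_genus {D : ι →₀ ℤ} (h : S.degree D + 1 - S.genus < S.dim D) :
    (S.dim D : ℤ) ≤ S.genus := by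
  classical
  obtain ⟨⟨D₀, hD₀⟩, hmin⟩ := S.genus_spec
  have hmax (E : ι →₀ ℤ) (hE : D₀ ≤ E) : (S.dim E : ℤ) = S.degree E + 1 - S.genus := by
    have := S.degree_sub_dim_mono hE
    have := hmin E
    linarith
  let R := LinearMap.range (diag k K ι)
  have hstable {E F : ι →₀ ℤ} (hE : D₀ ≤ E) (hEF : E ≤ F) : S.adele F ≤ S.adele E ⊔ R := by
    obtain ⟨n, hn, hn'⟩ := S.relLength_adele_sup hEF
    rw [hmax E hE, hmax F (hE.trans hEF)] at hn'
    have h0 : n = 0 := by omega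
    rw [h0, Nat.cast_zero, relLength_eq_zero] at hn
    exact le_sup_left.trans hn
  -- a linear form `l` vanishing on the adeles bounded by `D` and on `R`, but not at `a`
  obtain ⟨a, ha, haD⟩ : ∃ a ∈ S.adele (D ⊔ D₀), a ∉ S.adele D ⊔ R := by
    by_contra! H
    obtain ⟨n, hn, hn'⟩ := S.relLength_adele_sup (le_sup_left : D ≤ D ⊔ D₀)
    rw [relLength_eq_zero.2 (sup_le H le_sup_right)] at hn
    have h0 : n = 0 := by exact_mod_cast hn.symm
    rw [hmax _ le_sup_right] at hn'
    omega
  obtain ⟨l, hla, hl⟩ := Submodule.exists_le_ker_of_notMem haD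
  have hlD (b : ι → K) (hb : b ∈ S.adele D) : l b = 0 := hl (Submodule.mem_sup_left hb)
  have hlR (f : K) : l (diag k K ι f) = 0 := hl (Submodule.mem_sup_right ⟨f, rfl⟩)
  let E := D₀ ⊔ 0
  let U := S.adele E ⊔ R
  let U₀ := S.adele 0 ⊔ R
  have hEE : (0 : ι →₀ ℤ) ≤ E := le_sup_right
  obtain ⟨n, hn, hn'⟩ := S.relLength_adele_sup hEE
  have hng : (n : ℤ) = S.genus := by
    rw [hn', hmax E le_sup_left, degree_zero, dim_zero]
    push_cast
    ring
  let Q := U ⧸ U₀.submoduleOf U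
  have hQ : Module.length k Q = n := hn
  have : IsNoetherian k Q := (isFiniteLength_iff_isNoetherian_isArtinian.1
    (Module.length_ne_top_iff.1 (hQ ▸ ENat.natCast_ne_top n))).1
  have hfr : Module.finrank k Q = n := by
    rw [Module.length_eq_finrank] at hQ
    exact_mod_cast hQ
  -- the multiples of `l` by the elements of `L(D)`, as linear forms on `U / U₀`
  let mulf (f : K) : (ι → K) →ₗ[k] (ι → K) := LinearMap.pi fun i =>
    LinearMap.mulLeft k f ∘ₗ LinearMap.proj i
  have hker (f : S.space D) : U₀.submoduleOf U ≤ LinearMap.ker ((l ∘ₗ mulf f) ∘ₗ U.subtype) := by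
    have : U₀ ≤ LinearMap.ker (l ∘ₗ mulf f) := by
      refine sup_le (fun b hb => ?_) ?_
      · have := S.mul_mem_adele f.2 hb
        rw [add_zero] at this
        exact hlD _ this
      · rintro _ ⟨h, rfl⟩
        exact hlR ((f : K) * h)
    exact fun b hb => this hb
  let Φ : S.space D →ₗ[k] Module.Dual k Q :=
    { toFun := fun f => Submodule.liftQ _ ((l ∘ₗ mulf f) ∘ₗ U.subtype) (hker f)
      map_add' := fun f g => by
        refine Submodule.linearMap_qext _ (LinearMap.ext fun b => ?_)
        change l (mulf ((f : K) + g) b) = l (mulf f b) + l (mulf g b)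
        rw [← map_add]
        congr 1
        funext i
        exact add_mul _ _ _
      map_smul' := fun c f => by
        refine Submodule.linearMap_qext _ (LinearMap.ext fun b => ?_)
        change l (mulf (c • (f : K)) b) = c • l (mulf f b)
        rw [← map_smul]
        congr 1
        funext i
        exact smul_mul_assoc _ _ _ }
  have hΦ : Function.Injective Φ := by
    rw [injective_iff_map_eq_zero]
    intro f hf
    by_contra hf0
    have hf0 : (f : K) ≠ 0 := fun h => hf0 (Subtype.ext h)
    have hfU (b : ι → K) (hb : b ∈ U) : l (mulf f b) = 0 :=
      congrArg (fun φ : Module.Dual k Q => φ (Submodule.Quotient.mk ⟨b, hb⟩)) hf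
    -- `f⁻¹ a` lies in `U`, since `U` contains all bounded adeles
    obtain ⟨C, hC, hfC⟩ := S.exists_mem_space (f : K)⁻¹
    have h1 := S.mul_mem_adele hfC ha
    have h2 := hfU _ (hstable (le_sup_left : D₀ ≤ E) (le_sup_left : E ≤ E ⊔ (C + D ⊔ D₀))
      (S.adele_mono le_sup_right h1))
    refine hla ?_
    rw [← h2]
    congr 1
    funext i
    change a i = f * ((f : K)⁻¹ * a i)
    rw [mul_inv_cancel_left₀ hf0]
  have := LinearMap.finrank_le_finrank_of_injective hΦ
  rw [Subspace.dual_finrank_eq, hfr] at this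
  rw [← hng]
  exact_mod_cast this

theorem dim_eq_of_lt_degree {D : ι →₀ ℤ} (h : 2 * S.genus - 2 < S.degree D) :
    (S.dim D : ℤ) = S.degree D + 1 - S.genus := by
  refine le_antisymm ?_ (S.genus_spec.2 D)
  by_contra! hlt
  have := S.dim_le_genus hlt
  linarith

end FunctionFieldPlaces

/-! ### Algebras étale over a polynomial ring in one variable -/

section Etale

variable {k A B K : Type u} [Field k] [CommRing A] [IsDomain A] [Algebra k A]
  [Algebra (MvPolynomial (Fin 1) k) A] [IsScalarTower k (MvPolynomial (Fin 1) k) A]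
  [Algebra.Etale (MvPolynomial (Fin 1) k) A]

theorem trdeg_le_one_of_etale [Field K] [Algebra k K] [Algebra A K] [IsScalarTower k A K]
    [IsFractionRing A K] : Algebra.trdeg k K ≤ 1 := by
  let R := MvPolynomial (Fin 1) k
  let := ((algebraMap A K).comp (algebraMap R A)).toAlgebra
  have : IsScalarTower R A K := .of_algebraMap_eq fun _ => rfl
  have : IsScalarTower k R K := .of_algebraMap_eq fun c => by
    rw [IsScalarTower.algebraMap_apply k A K, IsScalarTower.algebraMap_apply k R A]
    rfl
  have hinj : Function.Injective (algebraMap R K) :=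
    (FaithfulSMul.algebraMap_injective A K).comp (FaithfulSMul.algebraMap_injective R A)
  have : FaithfulSMul R K := (faithfulSMul_iff_algebraMap_injective R K).2 hinj
  have : Algebra.QuasiFinite R K := Algebra.QuasiFinite.trans R A K
  let F := FractionRing R
  let := FractionRing.liftAlgebra R K
  have : IsScalarTower R F K := FractionRing.isScalarTower_liftAlgebra R K
  have : Algebra.QuasiFinite F K := Algebra.QuasiFinite.of_restrictScalars R F K
  have : Module.Finite F K := Module.Finite.of_quasiFinite
  have : Algebra.IsAlgebraic R K :=
    (IsFractionRing.comap_isAlgebraic_iff (A := R) (K := F) (C := K)).2 inferInstance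
  rw [← trdeg_add_eq k R (A := K), (trdeg_eq_zero : Algebra.trdeg R K = 0), add_zero,
    MvPolynomial.trdeg_of_isDomain]
  simp

theorem not_isField_of_etale (p : Ideal A) [p.IsMaximal] [Algebra.FiniteType k A] [CommRing B]
    [Algebra A B] [IsLocalization.AtPrime B p] : ¬ IsField B := by
  intro hB
  let R := MvPolynomial (Fin 1) k
  let := Ideal.Quotient.field p
  have : Module.Finite k (A ⧸ p) := finite_of_finite_type_of_isJacobsonRing k (A ⧸ p)
  have : IsScalarTower k R (A ⧸ p) := .of_algebraMap_eq fun c => by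
    rw [IsScalarTower.algebraMap_apply k A (A ⧸ p), IsScalarTower.algebraMap_apply k R A]
    rfl
  -- the polynomial ring is not contained in the finite extension `A / p` of `k`
  have hni : ¬ Function.Injective (algebraMap R (A ⧸ p)) := fun hi => by
    have := Module.Finite.of_injective (IsScalarTower.toAlgHom k R (A ⧸ p)).toLinearMap hi
    exact MvPolynomial.transcendental_X k (0 : Fin 1)
      (Algebra.IsIntegral.isIntegral (R := k) _).isAlgebraic
  rw [injective_iff_map_eq_zero] at hni
  push Not at hni
  obtain ⟨r, hr, hr0⟩ := hni
  have hrp : algebraMap R A r ∈ p := Ideal.Quotient.eq_zero_iff_mem.1 hr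
  have hrA : algebraMap R A r ≠ 0 :=
    (map_ne_zero_iff _ (FaithfulSMul.algebraMap_injective R A)).2 hr0
  have hinj : Function.Injective (algebraMap A B) :=
    IsLocalization.injective B p.primeCompl_le_nonZeroDivisors
  have hrB : algebraMap A B (algebraMap R A r) ≠ 0 := (map_ne_zero_iff _ hinj).2 hrA
  obtain ⟨b, hb⟩ := hB.mul_inv_cancel hrB
  have : IsUnit (algebraMap A B (algebraMap R A r)) := .of_mul_eq_one b hb
  exact (IsLocalization.AtPrime.isUnit_to_map_iff B p _).1 this hrp

end Etale

open IntermediateField in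
/-- A finitely generated field of transcendence degree one is finite over the field generated by
any transcendental element; its degree is the maximal number of functions independent over the
polynomials in that element. -/
theorem exists_polyIndep_of_trdeg_le_one {k K : Type u} [Field k] [Field K] [Algebra k K]
    [Algebra.EssFiniteType k K] (h : Algebra.trdeg k K ≤ 1) {x : K} (hx : Transcendental k x) :
    ∃ m : ℕ, (∃ u : Fin m → K, PolyIndep (k := k) x u) ∧
      ∀ d : ℕ, ∀ z : Fin d → K, PolyIndep (k := k) x z → d ≤ m := by
  have hb : IsTranscendenceBasis k (fun _ : PUnit.{u + 1} => x) :=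
    (algebraicIndependent_unique_type_iff.2 hx).isTranscendenceBasis_of_trdeg_le_of_finite
      (by simpa using h)
  have halg := hb.isAlgebraic_field
  rw [Set.range_const] at halg
  have : Algebra.EssFiniteType k⟮x⟯ K := Algebra.EssFiniteType.of_comp k k⟮x⟯ K
  have : Module.Finite k⟮x⟯ K := Algebra.finite_of_essFiniteType_of_isAlgebraic
  have key {d : ℕ} (z : Fin d → K) : PolyIndep (k := k) x z ↔ LinearIndependent k⟮x⟯ z := by
    have hmem (p : Polynomial k) : Polynomial.aeval x p ∈ k⟮x⟯ :=
      algebra_adjoin_le_adjoin k _ (Polynomial.aeval_mem_adjoin_singleton k x)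
    rw [Fintype.linearIndependent_iff]
    constructor
    · intro hz c hc
      -- clear denominators in a relation over `k(x)`
      have hfrac (j : Fin d) : ∃ r s : Polynomial k, Polynomial.aeval x s ≠ 0 ∧
          (c j : K) * Polynomial.aeval x s = Polynomial.aeval x r := by
        obtain ⟨r, s, h⟩ := (mem_adjoin_simple_iff k _).1 (c j).2
        by_cases hs : Polynomial.aeval x s = 0
        · exact ⟨0, 1, by simp, by simp [h, hs]⟩
        · exact ⟨r, s, hs, by rw [h, div_mul_cancel₀ _ hs]⟩
      choose r s hs hrs using hfrac
      have h0 := hz (fun j => r j * ∏ i ∈ Finset.univ.erase j, s i) <| by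
        have : ∑ j, Polynomial.aeval x (r j * ∏ i ∈ Finset.univ.erase j, s i) * z j =
            Polynomial.aeval x (∏ i, s i) * ∑ j, c j • z j := by
          rw [Finset.mul_sum]
          refine Finset.sum_congr rfl fun j _ => ?_
          rw [← Finset.mul_prod_erase Finset.univ s (Finset.mem_univ j), map_mul, map_mul, ← hrs,
            Algebra.smul_def]
          change _ = _ * ((c j : K) * z j)
          ring
        rw [this, hc, mul_zero]
      intro j
      have h1 := congrArg (Polynomial.aeval x) (congrFun h0 j)
      simp only [map_mul, map_prod, Pi.zero_apply, map_zero, ← hrs] at h1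
      have h2 : ∏ i ∈ Finset.univ.erase j, Polynomial.aeval x (s i) ≠ 0 :=
        Finset.prod_ne_zero_iff.2 fun i _ => hs i
      exact Subtype.ext ((mul_eq_zero.1 ((mul_eq_zero.1 h1).resolve_right h2)).resolve_right (hs j))
    · intro hz p hp
      funext j
      have h1 := hz (fun j => ⟨Polynomial.aeval x (p j), hmem _⟩) hp j
      exact (transcendental_iff.1 hx) (p j) (congrArg Subtype.val h1)
  refine ⟨Module.finrank k⟮x⟯ K, ⟨Module.finBasis k⟮x⟯ K, (key _).2
    (Module.finBasis k⟮x⟯ K).linearIndependent⟩, fun d z hz => ?_⟩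
  simpa using ((key z).1 hz).fintype_card_le_finrank

namespace Curve

variable {k : Type u} [Field k] (C : Curve k)

/-! ### Charts of the curve -/

instance : CompactSpace C.X := (quasiCompact_iff_compactSpace C.toSpec).mp inferInstance

instance : JacobsonSpace C.X := LocallyOfFiniteType.jacobsonSpace C.toSpec

/-- The sections over an open set are a `k`-algebra. -/
noncomputable instance algebraSection (V : C.X.Opens) : Algebra k Γ(C.X, V) :=
  ((C.X.presheaf.map (homOfLE le_top : V ⟶ ⊤).op).hom.comp C.constants).toAlgebra

theorem germ_algebraMap (V : C.X.Opens) (x : C.X) (hx : x ∈ V) (c : k) :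
    C.X.presheaf.germ V x hx (algebraMap k Γ(C.X, V) c) = algebraMap k (C.X.presheaf.stalk x) c :=
  C.X.presheaf.germ_res_apply (homOfLE le_top : V ⟶ ⊤) x hx (C.constants c)

instance (V : C.X.Opens) [Nonempty V] : IsScalarTower k Γ(C.X, V) C.functionField :=
  .of_algebraMap_eq fun c => (C.germ_algebraMap V _ _ c).symm

instance (x : C.X) : IsScalarTower k (C.X.presheaf.stalk x) C.functionField :=
  .of_algebraMap_eq fun c => by
    have : Nonempty (⊤ : C.X.Opens) := ⟨⟨x, trivial⟩⟩
    exact (Scheme.algebraMap_germ_eq_germToFunctionField C.X (U := ⊤) trivial (C.constants c)).symm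

theorem hom_inv_comp_appLE (V : C.X.Opens) :
    ((Scheme.ΓSpecIso (.of k)).inv ≫ C.toSpec.appLE ⊤ V le_top).hom = algebraMap k Γ(C.X, V) := rfl

theorem finiteType_section {V : C.X.Opens} (hV : IsAffineOpen V) :
    Algebra.FiniteType k Γ(C.X, V) := by
  rw [← RingHom.finiteType_algebraMap, ← C.hom_inv_comp_appLE V, CommRingCat.hom_comp]
  exact (RingHom.finiteType_respectsIso.2 _
    (Scheme.ΓSpecIso (.of k)).symm.commRingCatIsoToRingEquiv
    (C.toSpec.finiteType_appLE (isAffineOpen_top _) hV le_top))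

theorem exists_etale_chart (x : C.X) : ∃ V : C.X.Opens, IsAffineOpen V ∧ x ∈ V ∧
    ∃ g : MvPolynomial (Fin 1) k →+* Γ(C.X, V),
      g.comp MvPolynomial.C = algebraMap k Γ(C.X, V) ∧ g.Etale := by
  obtain ⟨U, hU, V, hV, hxV, e, h⟩ :=
    SmoothOfRelativeDimension.exists_isStandardSmoothOfRelativeDimension (n := 1)
      (f := C.toSpec) x
  obtain rfl : U = ⊤ := by
    have hs : Subsingleton (Spec (.of k)) := inferInstance
    exact eq_top_iff.2 fun y _ => hs.elim (C.toSpec x) y ▸ e hxV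
  refine ⟨V, hV, hxV, RingHom.IsStandardSmoothOfRelativeDimension.exists_etale_mvPolynomial ?_⟩
  rw [← C.hom_inv_comp_appLE V, CommRingCat.hom_comp]
  exact (RingHom.isStandardSmoothOfRelativeDimension_respectsIso.2 _
    (Scheme.ΓSpecIso (.of k)).symm.commRingCatIsoToRingEquiv h)

theorem trdeg_functionField_le : Algebra.trdeg k C.functionField ≤ 1 := by
  obtain ⟨V, hV, hxV, g, hg, hge⟩ := C.exists_etale_chart (genericPoint C.X)
  have : Nonempty V := ⟨⟨_, hxV⟩⟩
  have := functionField_isFractionRing_of_isAffineOpen C.X V hV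
  algebraize [g]
  have : IsScalarTower k (MvPolynomial (Fin 1) k) Γ(C.X, V) := .of_algebraMap_eq' hg.symm
  exact trdeg_le_one_of_etale (A := Γ(C.X, V))

instance : Algebra.EssFiniteType k C.functionField := by
  obtain ⟨V, hV, hxV, -⟩ := C.exists_etale_chart (genericPoint C.X)
  have : Nonempty V := ⟨⟨_, hxV⟩⟩
  have := functionField_isFractionRing_of_isAffineOpen C.X V hV
  have := C.finiteType_section hV
  have : Algebra.EssFiniteType Γ(C.X, V) C.functionField :=
    .of_isLocalization _ (nonZeroDivisors Γ(C.X, V))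
  exact .comp k Γ(C.X, V) C.functionField

/-! ### Closed points -/

theorem coheight_closedPoint (x : C.ClosedPoint) : Order.coheight x.1 = 1 := by
  obtain ⟨V, hV, hxV, g, hg, hge⟩ := C.exists_etale_chart x.1
  have : Nonempty V := ⟨⟨_, hxV⟩⟩
  have hmax := hV.primeIdealOf_isMaximal_of_isClosed ⟨x.1, hxV⟩ x.2
  have := C.finiteType_section hV
  let := C.X.presheaf.algebra_section_stalk (⟨x.1, hxV⟩ : V)
  have := hV.isLocalization_stalk ⟨x.1, hxV⟩
  have hB : ¬ IsField (C.X.presheaf.stalk x.1) := by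
    algebraize [g]
    have : IsScalarTower k (MvPolynomial (Fin 1) k) Γ(C.X, V) := .of_algebraMap_eq' hg.symm
    exact not_isField_of_etale (k := k) (hV.primeIdealOf ⟨x.1, hxV⟩).asIdeal
  have := isDiscreteValuationRing_of_etale_polynomial hB g hge
    (hV.primeIdealOf ⟨x.1, hxV⟩).asIdeal
  have h1 := ringKrullDim_stalk_eq_coheight x.1
  rw [IsPrincipalIdealRing.ringKrullDim_eq_one _ hB] at h1
  exact_mod_cast h1.symm

instance (x : C.ClosedPoint) : IsDiscreteValuationRing (C.X.presheaf.stalk x.1) :=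
  C.isDiscreteValuationRing_stalk x.1 (C.coheight_closedPoint x)

instance finite_residueField (x : C.ClosedPoint) : Module.Finite k (C.X.residueField x.1) := by
  obtain ⟨V, hV, hxV, -⟩ := C.exists_etale_chart x.1
  have hmax := hV.primeIdealOf_isMaximal_of_isClosed ⟨x.1, hxV⟩ x.2
  have := C.finiteType_section hV
  let B := C.X.presheaf.stalk x.1
  let := C.X.presheaf.algebra_section_stalk (⟨x.1, hxV⟩ : V)
  have := hV.isLocalization_stalk ⟨x.1, hxV⟩
  let ev : Γ(C.X, V) →ₐ[k] C.X.residueField x.1 :=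
    { (C.X.evaluation V x.1 hxV).hom with
      commutes' := fun c => congrArg (C.X.residue x.1) (C.germ_algebraMap V x.1 hxV c) }
  have hsurj : Function.Surjective ev := by
    intro y
    obtain ⟨b, rfl⟩ := C.X.residue_surjective x.1 y
    let p := (hV.primeIdealOf ⟨x.1, hxV⟩).asIdeal
    obtain ⟨a, ha⟩ := (IsLocalization.AtPrime.equivQuotMaximalIdeal p B).surjective
      (Ideal.Quotient.mk _ b)
    obtain ⟨a, rfl⟩ := Ideal.Quotient.mk_surjective a
    exact ⟨a, ha⟩
  have : Algebra.FiniteType k (C.X.residueField x.1) := .of_surjective ev hsurj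
  exact finite_of_finite_type_of_isJacobsonRing k (C.X.residueField x.1)

end Curve

namespace Curve

variable {k : Type u} [Field k] (C : Curve k)

/-! ### Orders at closed points -/

theorem ord_algebraMap_isUnit (x : C.ClosedPoint) {s : C.X.presheaf.stalk x.1} (hs : IsUnit s) :
    Scheme.ord (algebraMap _ C.functionField s) x.1 = 0 := by
  have hx := C.coheight_closedPoint x
  rw [Scheme.ord_eq_iff hx (hs.map (algebraMap _ C.functionField)).ne_zero]
  have : Ring.KrullDimLE 1 (C.X.presheaf.stalk x.1) := krullDimLE_of_coheight_le hx.le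
  exact Ring.ordFrac_of_isUnit hs

theorem ord_algebraMap_irreducible (x : C.ClosedPoint) {s : C.X.presheaf.stalk x.1}
    (hs : Irreducible s) : Scheme.ord (algebraMap _ C.functionField s) x.1 = 1 := by
  have hx := C.coheight_closedPoint x
  rw [Scheme.ord_eq_iff hx ((map_ne_zero_iff _ (IsFractionRing.injective _ _)).2 hs.ne_zero)]
  exact Ring.ordFrac_irreducible hs

theorem ord_pow (x : C.X) {h : C.functionField} (hh : h ≠ 0) (n : ℕ) :
    Scheme.ord (h ^ n) x = n * Scheme.ord h x := by
  induction n with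
  | zero =>
    have := Scheme.ord_mul (x := x) (one_ne_zero (α := C.functionField)) one_ne_zero
    rw [mul_one] at this
    simp only [pow_zero, Nat.cast_zero, zero_mul]
    linarith
  | succ n ih => rw [pow_succ, Scheme.ord_mul (pow_ne_zero n hh) hh, ih]; push_cast; ring

theorem ord_algebraMap (x : C.ClosedPoint) {s : C.X.presheaf.stalk x.1} (hs : s ≠ 0) :
    0 ≤ Scheme.ord (algebraMap _ C.functionField s) x.1 ∧
      (1 ≤ Scheme.ord (algebraMap _ C.functionField s) x.1 ↔ C.X.residue x.1 s = 0) := by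
  obtain ⟨ϖ, hϖ⟩ := IsDiscreteValuationRing.exists_irreducible (C.X.presheaf.stalk x.1)
  obtain ⟨n, v, rfl⟩ := IsDiscreteValuationRing.eq_unit_mul_pow_irreducible hs hϖ
  have hinj := IsFractionRing.injective (C.X.presheaf.stalk x.1) C.functionField
  have hϖ0 : algebraMap _ C.functionField ϖ ≠ 0 := (map_ne_zero_iff _ hinj).2 hϖ.ne_zero
  have hord : Scheme.ord (algebraMap _ C.functionField (v * ϖ ^ n)) x.1 = n := by
    rw [map_mul, map_pow, Scheme.ord_mul ((map_ne_zero_iff _ hinj).2 v.ne_zero)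
      (pow_ne_zero n hϖ0), C.ord_algebraMap_isUnit x v.isUnit, C.ord_pow _ hϖ0,
      C.ord_algebraMap_irreducible x hϖ]
    simp
  have hres : C.X.residue x.1 (v * ϖ ^ n) = 0 ↔ ¬ IsUnit ((v : C.X.presheaf.stalk x.1) * ϖ ^ n) :=
    IsLocalRing.residue_eq_zero_iff _
  rw [hord, hres]
  refine ⟨Int.natCast_nonneg n, ?_⟩
  rw [Units.isUnit_units_mul, isUnit_pow_iff_of_not_isUnit hϖ.not_isUnit]
  omega

theorem mem_range_of_ord_nonneg (x : C.ClosedPoint) {h : C.functionField}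
    (hh : h ≠ 0 → 0 ≤ Scheme.ord h x.1) :
    h ∈ (algebraMap (C.X.presheaf.stalk x.1) C.functionField).range := by
  by_cases h0 : h = 0
  · exact h0 ▸ zero_mem _
  rcases ValuationRing.isInteger_or_isInteger (C.X.presheaf.stalk x.1) h with h1 | ⟨s, hs⟩
  · exact h1
  have hs0 : s ≠ 0 := fun h1 => by rw [h1, map_zero] at hs; exact inv_ne_zero h0 hs.symm
  have h2 := Scheme.ord_mul (x := x.1) h0 (inv_ne_zero h0)
  rw [mul_inv_cancel₀ h0, ← hs, ← map_one (algebraMap (C.X.presheaf.stalk x.1) _),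
    C.ord_algebraMap_isUnit x isUnit_one] at h2
  -- an inverse of nonpositive order is a unit of the local ring
  have hu : IsUnit s := by
    by_contra hu
    have := (C.ord_algebraMap x hs0).2.2 ((IsLocalRing.residue_eq_zero_iff _).2 hu)
    have := hh h0
    omega
  obtain ⟨v, rfl⟩ := hu
  refine ⟨(v⁻¹ : (C.X.presheaf.stalk x.1)ˣ), ?_⟩
  rw [← inv_inv h, ← hs]
  exact eq_inv_of_mul_eq_one_left (by rw [← map_mul, Units.inv_mul, map_one])

/-- The orders of functions at the closed points of the curve. -/
noncomputable def orders : DiscreteOrders k C.functionField C.ClosedPoint where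
  ord x h := Scheme.ord h x.1
  ord_mul _ _ _ hf hg := Scheme.ord_mul hf hg
  ord_add _ _ _ _ _ hfg := Scheme.ord_add hfg
  ord_algebraMap x c hc := by
    rw [IsScalarTower.algebraMap_apply k (C.X.presheaf.stalk x.1) C.functionField]
    exact C.ord_algebraMap_isUnit x ((isUnit_iff_ne_zero.2 hc).map _)

theorem relLength_orders (x : C.ClosedPoint) :
    Submodule.relLength (C.orders.filt x 1) (C.orders.filt x 0) = x.degree := by
  let R := C.X.presheaf.stalk x.1
  let j : R →ₗ[k] C.functionField := (IsScalarTower.toAlgHom k R C.functionField).toLinearMap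
  have hinj : Function.Injective j := IsFractionRing.injective R C.functionField
  let res : R →ₗ[k] C.X.residueField x.1 :=
    { toFun := C.X.residue x.1
      map_add' := map_add _
      map_smul' := fun c s => by
        rw [Algebra.smul_def, map_mul, Algebra.smul_def]
        rfl }
  have h0 : C.orders.filt x 0 = (⊤ : Submodule k R).map j := by
    ext h
    constructor
    · intro hh
      obtain ⟨s, hs⟩ := C.mem_range_of_ord_nonneg x hh
      exact ⟨s, trivial, hs⟩
    · rintro ⟨s, -, rfl⟩ hs
      exact (C.ord_algebraMap x fun h => hs (by rw [h, map_zero])).1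
  have h1 : C.orders.filt x 1 = (LinearMap.ker res).map j := by
    ext h
    constructor
    · intro hh
      obtain ⟨s, rfl⟩ := C.mem_range_of_ord_nonneg x fun h0 => zero_le_one.trans (hh h0)
      refine ⟨s, ?_, rfl⟩
      by_cases hs : s = 0
      · exact hs ▸ zero_mem _
      · exact (C.ord_algebraMap x hs).2.1 (hh ((map_ne_zero_iff _ hinj).2 hs))
    · rintro ⟨s, hs, rfl⟩ hs0
      exact (C.ord_algebraMap x fun h => hs0 (by rw [h, map_zero])).2.2 hs
  rw [h0, h1, Submodule.relLength_map hinj, ClosedPoint.degree, ← Module.length_eq_finrank]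
  refine Submodule.relLength_eq_length (res ∘ₗ (⊤ : Submodule k R).subtype) ?_ fun b => Iff.rfl
  intro y
  obtain ⟨s, rfl⟩ := C.X.residue_surjective x.1 y
  exact ⟨⟨s, trivial⟩, rfl⟩

/-! ### Zeros and poles are finite in number -/

theorem eq_or_eq_genericPoint {x : C.ClosedPoint} {y : C.X} (h : y ⤳ x.1) :
    y = x.1 ∨ y = genericPoint C.X := by
  by_contra! hne
  have hη : genericPoint C.X ⤳ y := (genericPoint_spec C.X).specializes trivial
  have h1 : x.1 < y := lt_of_le_not_ge h fun h' => hne.1 (h.antisymm h').eq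
  have h2 : y < genericPoint C.X :=
    lt_of_le_not_ge hη fun h' => hne.2 (Specializes.antisymm h' hη).eq
  have h3 := Order.coheight_add_one_le h1
  have h4 := Order.coheight_add_one_le h2
  rw [C.coheight_closedPoint x] at h3
  have h5 : (1 : ℕ∞) ≤ Order.coheight y := le_trans le_add_self h4
  have h6 : (1 : ℕ∞) + 1 ≤ 1 := (add_le_add_left h5 1).trans h3
  exact absurd h6 (by decide)

theorem finite_closedPoint_of_isClosed {Z : Set C.X} (hZ : IsClosed Z)
    (hη : genericPoint C.X ∉ Z) : {x : C.ClosedPoint | x.1 ∈ Z}.Finite := by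
  have : IsNoetherian C.X := {}
  have hfin := TopologicalSpace.NoetherianSpace.finite_irreducibleComponents (α := Z)
  -- the points in question are irreducible components of `Z`
  have hcomp (x : C.ClosedPoint) (hx : x.1 ∈ Z) :
      ({⟨x.1, hx⟩} : Set Z) ∈ irreducibleComponents Z := by
    refine ⟨isIrreducible_singleton, fun T hT hle w hw => ?_⟩
    have hT' : IsIrreducible (closure (Subtype.val '' T : Set C.X)) :=
      (hT.image _ continuous_subtype_val.continuousOn).closure
    obtain ⟨y, hy⟩ := QuasiSober.sober hT' isClosed_closure
    have hTZ : closure (Subtype.val '' T : Set C.X) ⊆ Z :=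
      closure_minimal (by rintro _ ⟨t, -, rfl⟩; exact t.2) hZ
    have hyx : y ⤳ x.1 := hy.specializes (subset_closure ⟨_, hle rfl, rfl⟩)
    rcases C.eq_or_eq_genericPoint hyx with h | h
    · have hxw : x.1 ⤳ w.1 := h ▸ hy.specializes (subset_closure ⟨w, hw, rfl⟩)
      exact Subtype.ext (hxw.mem_closed x.2 rfl)
    · exact absurd (hTZ (h ▸ hy.mem)) hη
  refine Set.Finite.of_finite_image (f := fun x : C.ClosedPoint => {w : Z | w.1 = x.1})
    (hfin.subset ?_) ?_
  · rintro _ ⟨x, hx, rfl⟩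
    convert hcomp x hx
    ext w
    simp [Subtype.ext_iff]
  · intro x hx y hy hxy
    have h : {w : Z | w.1 = x.1} = {w : Z | w.1 = y.1} := hxy
    have : (⟨x.1, hx⟩ : Z) ∈ {w : Z | w.1 = y.1} := by
      rw [← h]
      rfl
    exact Subtype.ext this

theorem finite_ord_ne_zero {h : C.functionField} (h0 : h ≠ 0) :
    {x : C.ClosedPoint | Scheme.ord h x.1 ≠ 0}.Finite := by
  obtain ⟨U, -, f, hU, rfl, hf⟩ := exists_isUnit_germ_eq C.X h h0
  refine (C.finite_closedPoint_of_isClosed U.isOpen.isClosed_compl ?_).subset fun x hx hxU =>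
    hx (Scheme.ord_of_isUnit hf hxU)
  rw [Set.notMem_compl_iff]
  exact ((genericPoint_spec C.X).mem_open_set_iff U.isOpen).mpr (by simpa using hU)

/-! ### Distinct points have incomparable local rings -/

instance : C.X.IsSeparated :=
  ⟨by
    rw [← Limits.terminal.comp_from C.toSpec]
    infer_instance⟩

/-- If the local ring of `x` were contained in that of `y`, the inclusion would make `Spec` of the
latter factor through `Spec` of the former over the curve, by separatedness; so `y` would specialize
to `x`. -/
theorem exists_ord_nonneg_ord_neg {x y : C.ClosedPoint} (hxy : x ≠ y) :
    ∃ h : C.functionField, h ≠ 0 ∧ 0 ≤ Scheme.ord h x.1 ∧ Scheme.ord h y.1 < 0 := by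
  by_contra! H
  let K := C.functionField
  let R := C.X.presheaf.stalk x.1
  let S := C.X.presheaf.stalk y.1
  have hRS (s : R) : algebraMap R K s ∈ (algebraMap S K).range :=
    C.mem_range_of_ord_nonneg y fun h0 =>
      H _ h0 (C.ord_algebraMap x fun h => h0 (by rw [h, map_zero])).1
  let e := RingEquiv.ofBijective (algebraMap S K).rangeRestrict
    ⟨fun a b hab => IsFractionRing.injective S K (congrArg Subtype.val hab),
      (algebraMap S K).rangeRestrict_surjective⟩
  let φ : R →+* S := (e.symm : (algebraMap S K).range →+* S).comp
    ((algebraMap R K).codRestrict _ hRS)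
  have hφ (s : R) : algebraMap S K (φ s) = algebraMap R K s :=
    congrArg Subtype.val (e.apply_symm_apply ⟨_, hRS s⟩)
  have hη (z : C.X) : genericPoint C.X ⤳ z := (genericPoint_spec C.X).specializes trivial
  let Φ : C.X.presheaf.stalk x.1 ⟶ C.X.presheaf.stalk y.1 := CommRingCat.ofHom φ
  have hΦ : Φ ≫ C.X.presheaf.stalkSpecializes (hη y.1) =
      C.X.presheaf.stalkSpecializes (hη x.1) := by
    ext s
    exact hφ s
  have hdom : IsDominant (Spec.map (C.X.presheaf.stalkSpecializes (hη y.1))) := by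
    refine ⟨PrimeSpectrum.denseRange_comap_iff_ker_le_nilRadical _ |>.2 ?_⟩
    have : RingHom.ker (algebraMap S K) = ⊥ :=
      (RingHom.injective_iff_ker_eq_bot _).1 (IsFractionRing.injective S K)
    exact this.le.trans bot_le
  have heq : Spec.map Φ ≫ C.X.fromSpecStalk x.1 = C.X.fromSpecStalk y.1 := by
    refine ext_of_isDominant (Spec.map (C.X.presheaf.stalkSpecializes (hη y.1))) ?_
    rw [← Category.assoc, ← Spec.map_comp, hΦ, Scheme.SpecMap_stalkSpecializes_fromSpecStalk,
      Scheme.SpecMap_stalkSpecializes_fromSpecStalk]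
  have hmem : y.1 ∈ Set.range (C.X.fromSpecStalk x.1) := by
    have h1 : C.X.fromSpecStalk y.1 (IsLocalRing.closedPoint S) = y.1 :=
      Scheme.fromSpecStalk_closedPoint
    rw [← heq] at h1
    exact ⟨_, h1⟩
  rw [Scheme.range_fromSpecStalk] at hmem
  have h2 : x.1 ∈ ({y.1} : Set C.X) := Specializes.mem_closed hmem y.2 rfl
  exact hxy (Subtype.ext h2)

/-! ### Functions without poles are constant -/

theorem exists_section_of_ord_nonneg {h : C.functionField}
    (hh : ∀ x : C.ClosedPoint, 0 ≤ Scheme.ord h x.1) [Nonempty (⊤ : C.X.Opens)] :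
    ∃ s : Γ(C.X, ⊤), C.X.germToFunctionField ⊤ s = h := by
  have hloc (x : C.ClosedPoint) : ∃ (V : C.X.Opens) (hV : Nonempty V) (_ : x.1 ∈ V) (s : Γ(C.X, V)),
      C.X.germToFunctionField V s = h := by
    obtain ⟨t, ht⟩ := C.mem_range_of_ord_nonneg x fun _ => hh x
    obtain ⟨V, hV, s, rfl⟩ := C.X.presheaf.exists_germ_eq t
    have : Nonempty V := ⟨⟨_, hV⟩⟩
    exact ⟨V, this, hV, s, by rw [← ht, Scheme.algebraMap_germ_eq_germToFunctionField]⟩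
  choose V hVn hxV s hs using hloc
  have hη (U : C.X.Opens) [hU : Nonempty U] : genericPoint C.X ∈ U :=
    ((genericPoint_spec C.X).mem_open_set_iff U.isOpen).mpr (by simpa using hU)
  have hcover : (⊤ : C.X.Opens) ≤ iSup V := by
    by_contra hne
    have hne' : ((iSup V : C.X.Opens) : Set C.X)ᶜ.Nonempty := by
      rw [Set.nonempty_compl]
      intro h
      refine hne fun x _ => ?_
      have : x ∈ ((iSup V : C.X.Opens) : Set C.X) := by
        rw [h]
        trivial
      exact this
    obtain ⟨x, hx, hxc⟩ := nonempty_inter_closedPoints hne'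
      (iSup V).isOpen.isClosed_compl.isLocallyClosed
    exact hx ((le_iSup V ⟨x, hxc⟩ : V ⟨x, hxc⟩ ≤ iSup V) (hxV ⟨x, hxc⟩))
  obtain ⟨t, ht, -⟩ := C.X.sheaf.existsUnique_gluing' V ⊤ (fun x => homOfLE le_top) hcover s <| by
    intro x y
    have hmem : genericPoint C.X ∈ V x ⊓ V y := ⟨hη (V x), hη (V y)⟩
    refine germ_injective_of_isIntegral C.X (genericPoint C.X) hmem ?_
    refine (C.X.presheaf.germ_res_apply _ _ hmem (s x)).trans (((hs x).trans (hs y).symm).trans ?_)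
    exact (C.X.presheaf.germ_res_apply _ _ hmem (s y)).symm
  obtain ⟨x⟩ : Nonempty C.ClosedPoint := by
    obtain ⟨x, -, hx⟩ := nonempty_inter_closedPoints (X := C.X) (Z := Set.univ)
      ⟨genericPoint C.X, trivial⟩ isClosed_univ.isLocallyClosed
    exact ⟨⟨x, hx⟩⟩
  refine ⟨t, ?_⟩
  rw [← hs x, ← ht x]
  exact (C.X.presheaf.germ_res_apply (homOfLE le_top : V x ⟶ ⊤) _ (hη (V x)) t).symm

theorem fromSpec_comp_toSpec {V : C.X.Opens} (hV : IsAffineOpen V) :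
    hV.fromSpec ≫ C.toSpec = Spec.map (CommRingCat.ofHom (algebraMap k Γ(C.X, V))) := by
  rw [← (isAffineOpen_top (Spec (.of k))).SpecMap_appLE_fromSpec C.toSpec hV le_top,
    IsAffineOpen.fromSpec_top, Scheme.isoSpec_Spec_inv, ← Spec.map_comp]
  rfl

/-- The coordinate rings of a geometrically integral curve remain domains after every extension of
the base field. -/
theorem isDomain_tensorProduct {V : C.X.Opens} (hV : IsAffineOpen V) [Nonempty V] (F : Type u)
    [Field F] [Algebra k F] : IsDomain (TensorProduct k Γ(C.X, V) F) := by
  let f := Spec.map (CommRingCat.ofHom (algebraMap k Γ(C.X, V)))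
  let g := Spec.map (CommRingCat.ofHom (algebraMap k F))
  have hint : AlgebraicGeometry.IsIntegral (Limits.pullback C.toSpec g) :=
    pullback_of_geometrically C.geomIntegral.geometrically_isIntegral F g
  let i : Limits.pullback f g ⟶ Limits.pullback C.toSpec g :=
    Limits.pullback.map f g C.toSpec g hV.fromSpec (𝟙 _) (𝟙 _)
      (by rw [Category.comp_id, C.fromSpec_comp_toSpec hV])
      (by rw [Category.comp_id, Category.id_comp])
  have : IsOpenImmersion i := inferInstance
  let j : Spec (.of (TensorProduct k Γ(C.X, V) F)) ⟶ Limits.pullback C.toSpec g :=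
    (pullbackSpecIso k Γ(C.X, V) F).inv ≫ i
  have : Nontrivial (TensorProduct k Γ(C.X, V) F) := inferInstance
  have : Nonempty (Spec (.of (TensorProduct k Γ(C.X, V) F))) :=
    inferInstanceAs (Nonempty (PrimeSpectrum (TensorProduct k Γ(C.X, V) F)))
  have := isIntegral_of_isOpenImmersion j
  exact (affine_isIntegral_iff (.of (TensorProduct k Γ(C.X, V) F))).1 this

/-- The global sections form a finite extension field `F` of `k`, and `F ⊗ F` is a domain, hence a
field; so the multiplication `F ⊗ F → F` is injective, and `[F : k]² ≤ [F : k]`. -/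
theorem mem_range_of_section [Nonempty (⊤ : C.X.Opens)] (s : Γ(C.X, ⊤)) :
    s ∈ (algebraMap k Γ(C.X, ⊤)).range := by
  obtain ⟨V, hV, hxV, -⟩ := C.exists_etale_chart (genericPoint C.X)
  have : Nonempty V := ⟨⟨_, hxV⟩⟩
  let F := Γ(C.X, ⊤)
  let := (isField_of_universallyClosed k C.toSpec).toField
  have hfin : Module.Finite k F := by
    rw [← RingHom.finite_algebraMap, ← C.hom_inv_comp_appLE ⊤, CommRingCat.hom_comp]
    refine RingHom.finite_respectsIso.2 _
      (Scheme.ΓSpecIso (.of k)).symm.commRingCatIsoToRingEquiv ?_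
    have := finite_appTop_of_universallyClosed k C.toSpec
    rwa [Scheme.Hom.appTop, Scheme.Hom.app_eq_appLE] at this
  let r : F →ₐ[k] Γ(C.X, V) :=
    { (C.X.presheaf.map (homOfLE le_top : V ⟶ ⊤).op).hom with
      commutes' := fun c => by
        refine germ_injective_of_isIntegral C.X (genericPoint C.X) hxV ?_
        refine (C.X.presheaf.germ_res_apply _ _ hxV _).trans ?_
        exact (C.germ_algebraMap ⊤ _ _ c).trans (C.germ_algebraMap V _ hxV c).symm }
  have hr : Function.Injective r := r.toRingHom.injective
  have hdom : IsDomain (TensorProduct k F F) := by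
    have := C.isDomain_tensorProduct hV F
    have hinj : Function.Injective (Algebra.TensorProduct.map r (AlgHom.id k F)) :=
      Module.Flat.rTensor_preserves_injective_linearMap (M := F) r.toLinearMap hr
    exact hinj.isDomain (Algebra.TensorProduct.map r (AlgHom.id k F)).toRingHom
  have hfield : IsField (TensorProduct k F F) :=
    isField_of_isIntegral_of_isField' (R := k) (Field.toIsField k)
  let := hfield.toField
  have hmul : Function.Injective (Algebra.TensorProduct.lmul' k (S := F)) :=
    (Algebra.TensorProduct.lmul' k (S := F)).toRingHom.injective
  have h1 := LinearMap.finrank_le_finrank_of_injective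
    (f := (Algebra.TensorProduct.lmul' k (S := F)).toLinearMap) hmul
  rw [Module.finrank_tensorProduct] at h1
  have h2 : 0 < Module.finrank k F := Module.finrank_pos
  have h3 : Module.finrank k F = 1 := by nlinarith
  obtain ⟨c, hc⟩ := (finrank_eq_one_iff_of_nonzero' (1 : F) one_ne_zero).1 h3 s
  exact ⟨c, by rw [← hc, Algebra.smul_def, mul_one]⟩

theorem mem_range_of_ord_nonneg_all {h : C.functionField}
    (hh : ∀ x : C.ClosedPoint, 0 ≤ Scheme.ord h x.1) :
    h ∈ (algebraMap k C.functionField).range := by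
  have : Nonempty (⊤ : C.X.Opens) := ⟨⟨genericPoint C.X, trivial⟩⟩
  obtain ⟨s, rfl⟩ := C.exists_section_of_ord_nonneg hh
  obtain ⟨c, rfl⟩ := C.mem_range_of_section s
  exact ⟨c, IsScalarTower.algebraMap_apply k Γ(C.X, ⊤) C.functionField c⟩

theorem transcendental_of_notMem_range {h : C.functionField}
    (hh : h ∉ (algebraMap k C.functionField).range) : Transcendental k h := by
  intro halg
  refine hh (C.mem_range_of_ord_nonneg_all fun x => ?_)
  have hint : IsIntegral (C.X.presheaf.stalk x.1) h := (isAlgebraic_iff_isIntegral.1 halg).tower_top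
  obtain ⟨s, rfl⟩ := IsIntegrallyClosed.isIntegral_iff.1 hint
  exact (C.ord_algebraMap x fun h => hh (by rw [h, map_zero]; exact zero_mem _)).1

/-- The closed points of a curve are the places of its function field. -/
noncomputable def places : FunctionFieldPlaces k C.functionField C.ClosedPoint where
  toDiscreteOrders := C.orders
  nonempty := by
    obtain ⟨x, -, hx⟩ := nonempty_inter_closedPoints (X := C.X) (Z := Set.univ)
      ⟨genericPoint C.X, trivial⟩ isClosed_univ.isLocallyClosed
    exact ⟨⟨x, hx⟩⟩
  exists_ord_eq_one x := by
    obtain ⟨ϖ, hϖ⟩ := IsDiscreteValuationRing.exists_irreducible (C.X.presheaf.stalk x.1)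
    exact ⟨algebraMap _ _ ϖ, (map_ne_zero_iff _ (IsFractionRing.injective _ _)).2 hϖ.ne_zero,
      C.ord_algebraMap_irreducible x hϖ⟩
  deg := ClosedPoint.degree
  relLength_residue := C.relLength_orders
  finite_support := C.finite_ord_ne_zero
  separated := C.exists_ord_nonneg_ord_neg
  mem_range _ := C.mem_range_of_ord_nonneg_all
  finite_rank hx := exists_polyIndep_of_trdeg_le_one C.trdeg_functionField_le
    (C.transcendental_of_notMem_range hx)

end Curve

namespace Curve

variable {k : Type u} [Field k] (C : Curve k)

/-! ### Algebraic geometry codes -/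

theorem space_places (D : C.Divisor) : C.places.space D = C.L D :=
  Submodule.ext fun _ => C.places.mem_space

theorem dim_places (D : C.Divisor) : C.places.dim D = Module.finrank k (C.L D) := by
  rw [FunctionFieldPlaces.dim, space_places]

theorem genus_places : C.places.genus = C.genus := by
  simp only [FunctionFieldPlaces.genus, dim_places]
  rfl

theorem bijective_algebraMap_residueField (x : C.RationalPoint) :
    Function.Bijective (algebraMap k (C.X.residueField x.1.1)) :=
  ⟨(algebraMap k _).injective, fun y => by
    obtain ⟨c, hc⟩ := (finrank_eq_one_iff_of_nonzero'
      (1 : C.X.residueField x.1.1) one_ne_zero).1 x.2 y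
    exact ⟨c, by rw [← hc, Algebra.smul_def, mul_one]⟩⟩

variable {C} in
theorem HasValueAt.unique {h : C.functionField} {x : C.RationalPoint} {a b : k}
    (ha : C.HasValueAt h x.1.1 a) (hb : C.HasValueAt h x.1.1 b) : a = b := by
  obtain ⟨s, hs, hs'⟩ := ha
  obtain ⟨t, ht, ht'⟩ := hb
  obtain rfl : s = t := IsFractionRing.injective _ C.functionField (hs.trans ht.symm)
  exact (C.bijective_algebraMap_residueField x).1 (hs'.symm.trans ht')

/-- At a rational point where the divisor `G` is trivial the functions of `L(G)` have values. -/
theorem exists_hasValueAt {G : C.Divisor} {h : C.functionField} (hh : h ∈ C.L G)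
    {x : C.RationalPoint} (hx : x.1 ∉ G.support) : ∃ c : k, C.HasValueAt h x.1.1 c := by
  rw [Finsupp.notMem_support_iff] at hx
  obtain ⟨s, hs⟩ := C.mem_range_of_ord_nonneg x.1 (h := h) fun h0 => by
    have := hh h0 x.1
    rwa [hx, add_zero] at this
  obtain ⟨c, hc⟩ := (C.bijective_algebraMap_residueField x).2 (C.X.residue x.1.1 s)
  exact ⟨c, s, hs, hc.symm⟩

theorem hasValueAt_zero_iff {h : C.functionField} (h0 : h ≠ 0) (x : C.ClosedPoint) :
    C.HasValueAt h x.1 0 ↔ 1 ≤ Scheme.ord h x.1 := by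
  constructor
  · rintro ⟨s, rfl, hs⟩
    rw [map_zero] at hs
    exact (C.ord_algebraMap x fun h => h0 (by rw [h, map_zero])).2.2 hs
  · intro h1
    obtain ⟨s, rfl⟩ := C.mem_range_of_ord_nonneg x fun _ => zero_le_one.trans h1
    refine ⟨s, rfl, ?_⟩
    rw [map_zero]
    exact (C.ord_algebraMap x fun h => h0 (by rw [h, map_zero])).2.1 h1

/-- A nonzero function of `L(G)` has at most `deg G` zeros among rational points outside the
support of `G`, for it lies in the Riemann–Roch space of `G` minus these points. -/
theorem card_le_degree {G : C.Divisor} {h : C.functionField} (h0 : h ≠ 0) (hh : h ∈ C.L G)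
    (T : Finset C.RationalPoint) (hG : ∀ x ∈ T, x.1 ∉ G.support)
    (hT : ∀ x ∈ T, C.HasValueAt h x.1.1 0) : (T.card : ℤ) ≤ G.degree := by
  classical
  -- the sum of the points of `T`
  let E : C.Divisor := Finsupp.indicator (T.map (Function.Embedding.subtype _)) fun _ _ => 1
  have hE (x : C.ClosedPoint) :
      E x = if x ∈ T.map (Function.Embedding.subtype _) then 1 else 0 := by
    simp only [E, Finsupp.indicator_apply, dite_eq_ite]
  have hdeg : C.places.degree E = T.card := by
    change E.sum _ = _
    rw [Finsupp.sum_of_support_subset E (Finsupp.support_indicator_subset _ _)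
      (fun x m => m * (C.places.deg x : ℤ)) fun x _ => zero_mul _, Finset.sum_map]
    have (x : C.RationalPoint) (hx : x ∈ T) : E x.1 * (C.places.deg x.1 : ℤ) = 1 := by
      have hm : x.1 ∈ T.map (Function.Embedding.subtype _) := Finset.mem_map.2 ⟨x, hx, rfl⟩
      rw [hE, if_pos hm]
      have : C.places.deg x.1 = 1 := x.2
      rw [this]
      rfl
    exact (Finset.sum_congr rfl this).trans (by simp)
  have hmem : h ∈ C.places.space (G - E) := by
    rw [FunctionFieldPlaces.mem_space]
    intro _ x
    have h1 := hh h0 x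
    change 0 ≤ Scheme.ord h x.1 + (G x - E x)
    rw [hE]
    split_ifs with hx
    · obtain ⟨y, hy, rfl⟩ := Finset.mem_map.1 hx
      have h2 := (C.hasValueAt_zero_iff h0 y.1).1 (hT y hy)
      have h3 : G y.1 = 0 := Finsupp.notMem_support_iff.1 (hG y hy)
      change 0 ≤ Scheme.ord h y.1.1 + (G y.1 - 1)
      linarith
    · rwa [sub_zero]
  have h1 := C.places.degree_nonneg_of_mem_space h0 hmem
  have h2 := C.places.degree_add (G - E) E
  rw [sub_add_cancel, hdeg] at h2
  change (T.card : ℤ) ≤ C.places.degree G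
  linarith

variable {n : ℕ} {P : Fin n → C.RationalPoint} {G : C.Divisor}

/-- The evaluation of the functions of `L(G)` at the points `P₁, …, Pₙ`. -/
noncomputable def evalMap (hG : ∀ i, (P i).1 ∉ G.support) : C.L G →ₗ[k] Fin n → k where
  toFun h i := (C.exists_hasValueAt h.2 (hG i)).choose
  map_add' h h' := by
    ext i
    refine (C.exists_hasValueAt (h + h').2 (hG i)).choose_spec.unique ?_
    obtain ⟨s, hs, hs'⟩ := (C.exists_hasValueAt h.2 (hG i)).choose_spec
    obtain ⟨t, ht, ht'⟩ := (C.exists_hasValueAt h'.2 (hG i)).choose_spec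
    exact ⟨s + t, by rw [map_add, hs, ht]; rfl, by rw [map_add, hs', ht', Pi.add_apply, map_add]⟩
  map_smul' c h := by
    ext i
    refine (C.exists_hasValueAt (c • h).2 (hG i)).choose_spec.unique ?_
    obtain ⟨s, hs, hs'⟩ := (C.exists_hasValueAt h.2 (hG i)).choose_spec
    refine ⟨algebraMap k _ c * s, ?_, ?_⟩
    · rw [map_mul, hs, ← IsScalarTower.algebraMap_apply, ← Algebra.smul_def]
      rfl
    · rw [map_mul, hs', RingHom.id_apply, Pi.smul_apply, smul_eq_mul, map_mul]
      rfl

theorem hasValueAt_evalMap (hG : ∀ i, (P i).1 ∉ G.support) (h : C.L G) (i : Fin n) :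
    C.HasValueAt (h : C.functionField) (P i).1.1 (C.evalMap hG h i) :=
  (C.exists_hasValueAt h.2 (hG i)).choose_spec

theorem range_evalMap (hG : ∀ i, (P i).1 ∉ G.support) :
    LinearMap.range (C.evalMap hG) = C.agCode P G := by
  ext c
  constructor
  · rintro ⟨h, rfl⟩
    exact ⟨h, h.2, C.hasValueAt_evalMap hG h⟩
  · rintro ⟨h, hh, hc⟩
    exact ⟨⟨h, hh⟩, funext fun i => (C.hasValueAt_evalMap hG ⟨h, hh⟩ i).unique (hc i)⟩

open scoped Classical in
theorem card_zeros_le_degree (hP : Function.Injective P) (hG : ∀ i, (P i).1 ∉ G.support)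
    {h : C.L G} (h0 : h ≠ 0) :
    ((Finset.univ.filter fun i => C.evalMap hG h i = 0).card : ℤ) ≤ G.degree := by
  rw [← Finset.card_map ⟨P, hP⟩]
  refine C.card_le_degree (fun h' => h0 (Subtype.ext h')) h.2 _ ?_ ?_
  · simp only [Finset.mem_map]
    rintro _ ⟨i, -, rfl⟩
    exact hG i
  · simp only [Finset.mem_map, Finset.mem_filter]
    rintro _ ⟨i, ⟨-, hi⟩, rfl⟩
    exact hi ▸ C.hasValueAt_evalMap hG h i

theorem evalMap_injective (hP : Function.Injective P) (hG : ∀ i, (P i).1 ∉ G.support)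
    (hdeg : G.degree < n) : Function.Injective (C.evalMap hG) := by
  classical
  rw [injective_iff_map_eq_zero]
  intro h hh
  by_contra h0
  have := C.card_zeros_le_degree hP hG h0
  simp only [hh, Pi.zero_apply, Finset.filter_true, Finset.card_univ, Fintype.card_fin] at this
  omega

theorem finrank_agCode (hP : Function.Injective P) (hG : ∀ i, (P i).1 ∉ G.support)
    (hdeg : G.degree < n) :
    Module.finrank k (C.agCode P G) = Module.finrank k (C.L G) := by
  rw [← C.range_evalMap hG, LinearMap.finrank_range_of_inj (C.evalMap_injective hP hG hdeg)]

/-- Distinct codewords agree in at most `deg G` positions, the zeros of a function of `L(G)`. -/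
theorem sub_degree_le_hammingDist [DecidableEq k] (hP : Function.Injective P)
    (hG : ∀ i, (P i).1 ∉ G.support) {a b : Fin n → k} (ha : a ∈ C.agCode P G)
    (hb : b ∈ C.agCode P G) (hab : a ≠ b) : n - G.degree ≤ hammingDist a b := by
  classical
  rw [← C.range_evalMap hG] at ha hb
  obtain ⟨h, rfl⟩ := ha
  obtain ⟨h', rfl⟩ := hb
  have h0 : h - h' ≠ 0 := fun h0 => hab (by rw [sub_eq_zero.1 h0])
  have h1 := C.card_zeros_le_degree hP hG h0
  simp only [map_sub, Pi.sub_apply, sub_eq_zero] at h1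
  have h2 := Finset.card_filter_add_card_filter_not (s := (Finset.univ : Finset (Fin n)))
    fun i => C.evalMap hG h i = C.evalMap hG h' i
  rw [Finset.card_univ, Fintype.card_fin] at h2
  have h3 : hammingDist (C.evalMap hG h) (C.evalMap hG h') =
      (Finset.univ.filter fun i => ¬ C.evalMap hG h i = C.evalMap hG h' i).card := by
    simp only [hammingDist, ne_eq]
  omega

end Curve

theorem mainTheorem4 {k : Type u} [Field k] [Finite k] (C : Curve k) {n : ℕ}
    (P : Fin n → C.RationalPoint) (hP : Function.Injective P) (G : C.Divisor)
    (hG : ∀ i, (P i).1 ∉ G.support) (hdeg : G.degree < n) :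
    (G.degree + 1 - C.genus ≤ Module.finrank k (C.agCode P G)) ∧
    (2 * C.genus - 2 < G.degree →
      (Module.finrank k (C.agCode P G) : ℤ) = G.degree + 1 - C.genus) ∧
    (∀ d : ℕ, IsMinDistance (C.agCode P G) d → n - G.degree ≤ d) := by
  rw [C.finrank_agCode hP hG hdeg, ← C.dim_places, ← C.genus_places]
  refine ⟨C.places.genus_spec.2 G, C.places.dim_eq_of_lt_degree, ?_⟩
  rintro d ⟨⟨a, ha, b, hb, hab, rfl⟩, -⟩
  classical
  exact C.sub_degree_le_hammingDist hP hG ha hb hab
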